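/- Let $K$ be a field and $A$ an infinite totally ordered alphabet (of order type $\omega$). A word $u$ over $\{1,2,\dots\}$ is packed if its set of letters is $\{1,\dots,p\}$ for some $p$; $\mathrm{PW}(n)$ is the set of packed words of length $n$, and $\mathrm{pack}(w)$ is obtained from a word $w$ over a totally ordered alphabet by replacing all occurrences of its $k$-th smallest letter by $k$. Let $\mathbf{WQSym}$ be the span, with coefficients in $K(t)$, of the noncommutative formal series $\mathbf M_u=\mathbf M_u(A)=\sum_{\mathrm{pack}(w)=u}w$ for $u$ packed. The partial products $\prec,\circ,\succ$ on $\mathbf{WQSym}$ are induced by the bilinear operations on series for which, for nonempty words $x,y$, the word $x\prec y$ (resp. $x\circ y$, $x\succ y$) is the concatenation $xy$ if $\max(x)>\max(y)$ (resp. $\max(x)=\max(y)$, $\max(x)<\max(y)$) and $0$ otherwise. Let $(\mathbf N_u)$ be the basis of the graded dual $\mathbf{WQSym}^*$ dual to $(\mathbf M_u)$, with internal product $\mathbf N_u*\mathbf N_v=\mathbf N_{\mathrm{pack}(u,v)}$ if $|u|=|v|$ (biletters being ordered lexicographically) and $0$ otherwise. The noncommutative symmetric functions embed in $\mathbf{WQSym}^*$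 by $S^I\mapsto\sum_{\mathrm{ev}(u)=I}\mathbf N_u$, where $\mathrm{ev}(u)$ is the composition whose $k$-th part is the number of occurrences of $k$ in $u$. Put $\Lambda_k=\sum_{I\vDash k}(-1)^{k-\ell(I)}S^I$ and $\sigma_1((1-t)A)=\big(\sum_k(-t)^k\Lambda_k\big)\big(\sum_kS_k\big)$, and let $\eta_t(\mathbf N_u)=\mathbf N_u*\sigma_1((1-t)A)$. Its adjoint $\eta_t^*$ on $\mathbf{WQSym}$ is written $f(A)\mapsto f(A\cdot(1-t))$. The specialization $f\mapsto f(\mathbb X)$, with $\mathbb X=\frac1{1-q}\,\hat\times\,(1-t)$, is the linear map obtained by applying $\eta_t^*$ and then replacing $A$ by the alphabet $\frac1{1-q}=\{\cdots<q^2<q<1\}$ of commuting letters; its values are formal power series in $q$ over $K(t)$, regarded as elements of the field $K(t)((q))$. For a nonempty packed word $w$, let $\mathrm{Nmax}(w)$ be the number of occurrences in $w$ of its maximal letter. **Theorem.** Let $n,m\ge1$, $u_1\in\mathrm{PW}(n)$ and $u_2\in\mathrm{PW}(m)$. Then $$(\mathbf M_{u_1}\prec\mathbf M_{u_2})(\mathbb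 X)=\frac{1-q^n}{1-q^{n+m}}\,\frac{q^m-t^{\mathrm{Nmax}(u_2)}}{1-t^{\mathrm{Nmax}(u_2)}}\,\mathbf M_{u_1}(\mathbb X)\,\mathbf M_{u_2}(\mathbb X),$$ $$(\mathbf M_{u_1}\circ\mathbf M_{u_2})(\mathbb X)=\frac{(1-q^n)(1-q^m)}{1-q^{n+m}}\,\frac{1-t^{\mathrm{Nmax}(u_1)+\mathrm{Nmax}(u_2)}}{(1-t^{\mathrm{Nmax}(u_1)})(1-t^{\mathrm{Nmax}(u_2)})}\,\mathbf M_{u_1}(\mathbb X)\,\mathbf M_{u_2}(\mathbb X),$$ $$(\mathbf M_{u_1}\succ\mathbf M_{u_2})(\mathbb X)=\frac{1-q^m}{1-q^{n+m}}\,\frac{q^n-t^{\mathrm{Nmax}(u_1)}}{1-t^{\mathrm{Nmax}(u_1)}}\,\mathbf M_{u_1}(\mathbb X)\,\mathbf M_{u_2}(\mathbb X).$$ -/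

import Mathlib

open scoped PowerSeries LaurentSeries

namespace WordQSym

/-! ### Words and packed words -/

section Words

variable {A : Type*} [LinearOrder A]

/-- The rank of the letter `a` among the distinct letters of the word `w`: it is `k` when `a` is the
`k`-th smallest letter of `w`. -/
def rank (w : List A) (a : A) : ℕ := (w.toFinset.filter (· ≤ a)).card

/-- The word obtained from `w` by replacing all occurrences of its `k`-th smallest letter by `k`. -/
def packList (w : List A) : List ℕ := w.map (rank w)

/-- A word over the positive integers is packed if its set of letters is `{1, …, p}` for some `p`
(the empty word is the packed word with `p = 0`). -/
def IsPacked (w : List ℕ) : Prop := ∃ p : ℕ, ∀ a : ℕ, a ∈ w ↔ 1 ≤ a ∧ a ≤ p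

/-- The type `PW` of packed words. -/
abbrev PackedWord : Type := {w : List ℕ // IsPacked w}

noncomputable instance : DecidableEq PackedWord := Classical.decEq _

theorem rank_strictMonoOn (w : List A) : StrictMonoOn (rank w) {a | a ∈ w} := by
  intro a _ b hb hab
  apply Finset.card_lt_card
  refine ⟨fun c hc => ?_, fun h => ?_⟩
  · simp only [Finset.mem_filter] at hc ⊢
    exact ⟨hc.1, hc.2.trans hab.le⟩
  · have : b ∈ w.toFinset.filter (· ≤ a) := h (by simpa using hb)
    simp only [Finset.mem_filter] at this
    exact absurd hab (not_lt.2 this.2)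

theorem isPacked_packList (w : List A) : IsPacked (packList w) := by
  refine ⟨w.toFinset.card, fun k => ?_⟩
  have himg : w.toFinset.image (rank w) = Finset.Icc 1 w.toFinset.card := by
    apply Finset.eq_of_subset_of_card_le
    · intro j hj
      obtain ⟨a, ha, rfl⟩ := Finset.mem_image.1 hj
      refine Finset.mem_Icc.2 ⟨Finset.card_pos.2 ⟨a, by simpa using ha⟩, ?_⟩
      exact Finset.card_le_card (Finset.filter_subset _ _)
    · rw [Finset.card_image_of_injOn, Nat.card_Icc]
      · omega
      · intro a ha b hb h
        exact (rank_strictMonoOn w).injOn (by simpa using ha) (by simpa using hb) h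
  have := congrArg (k ∈ ·) himg
  simpa [packList] using this

/-- The packed word `pack w` of a word `w` over a totally ordered alphabet. -/
def pack (w : List A) : PackedWord := ⟨packList w, isPacked_packList w⟩

@[simp] theorem length_packList (w : List A) : (packList w).length = w.length := by
  simp [packList]

theorem packList_map {B : Type*} [LinearOrder B] (f : A → B) (w : List A)
    (hf : StrictMonoOn f {a | a ∈ w}) : packList (w.map f) = packList w := by
  simp only [packList, List.map_map]
  refine List.map_congr_left fun a ha => ?_
  simp only [Function.comp, rank]
  have : ((w.map f).toFinset.filter (· ≤ f a)) = (w.toFinset.filter (· ≤ a)).image f := by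
    ext b
    simp only [Finset.mem_filter, List.mem_toFinset, List.mem_map, Finset.mem_image]
    constructor
    · rintro ⟨⟨c, hc, rfl⟩, hle⟩
      exact ⟨c, ⟨hc, (hf.le_iff_le hc ha).1 hle⟩, rfl⟩
    · rintro ⟨c, ⟨hc, hle⟩, rfl⟩
      exact ⟨⟨c, hc, rfl⟩, (hf.le_iff_le hc ha).2 hle⟩
  rw [this, Finset.card_image_of_injOn]
  intro x hx y hy h
  simp only [Finset.coe_filter, List.mem_toFinset, Set.mem_ofPred_eq] at hx hy
  exact hf.injOn hx.1 hy.1 h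

end Words

theorem packList_of_isPacked {w : List ℕ} (hw : IsPacked w) : packList w = w := by
  obtain ⟨p, hp⟩ := hw
  conv_rhs => rw [← List.map_id w]
  refine List.map_congr_left fun a ha => ?_
  have : w.toFinset.filter (· ≤ a) = Finset.Icc 1 a := by
    ext b
    have := (hp a).1 ha
    simp only [Finset.mem_filter, List.mem_toFinset, hp, Finset.mem_Icc]
    omega
  simp [rank, this]

@[simp] theorem pack_coe (u : PackedWord) : pack (u : List ℕ) = u :=
  Subtype.ext (packList_of_isPacked u.2)

theorem finite_packedWord_length (n : ℕ) : {u : PackedWord | u.1.length = n}.Finite := by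
  have hfin : {l : List (Fin (n + 1)) | l.length = n}.Finite := List.finite_length_eq _ n
  refine Set.Finite.subset (hfin.image fun l => pack (l.map Fin.val)) ?_
  intro u hu
  simp only [Set.mem_ofPred_eq] at hu
  obtain ⟨p, hp⟩ := u.2
  have hle : ∀ a ∈ u.1, a < n + 1 := by
    intro a ha
    have h1 : Finset.Icc 1 p ⊆ u.1.toFinset := fun b hb => by
      simpa [hp] using hb
    have h2 := Finset.card_le_card h1
    have h3 := List.toFinset_card_le u.1
    have h4 := ((hp a).1 ha).2
    simp at h2
    omega
  refine ⟨u.1.pmap (fun a h => ⟨a, h⟩) hle, by simpa using hu, ?_⟩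
  simp only [List.map_pmap]
  simp

/-- The finite set `PW(n)` of packed words of length `n`. -/
noncomputable def PW (n : ℕ) : Finset PackedWord := (finite_packedWord_length n).toFinset

@[simp] theorem mem_PW {n : ℕ} {u : PackedWord} : u ∈ PW n ↔ u.1.length = n := by
  simp [PW]

/-- The maximal letter of a word over the natural numbers (`0` for the empty word). -/
def maxLetter (w : List ℕ) : ℕ := w.foldr max 0

/-- The number of occurrences in `w` of its maximal letter. -/
def Nmax (w : List ℕ) : ℕ := w.count (maxLetter w)

/-- The evaluation of a packed word: the list of the numbers of occurrences of `1, 2, …, max u`. -/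
def ev (u : PackedWord) : List ℕ :=
  (List.range (maxLetter u.1)).map fun k => u.1.count (k + 1)

/-! ### Word quasi-symmetric functions and the three partial products -/

section WQSymDefs

variable (R : Type*) [CommRing R]

/-- Formal series in noncommuting variables indexed by the infinite totally ordered alphabet
`A = {0 < 1 < 2 < ⋯}`: the series `∑ f(w) w` is identified with its coefficient function `f`. -/
abbrev WordSeries : Type _ := List ℕ → R

/-- The series `M_u(A)`, the sum of all words `w` over `A` with `pack w = u`. -/
noncomputable def wordM (u : PackedWord) : WordSeries R := fun w => if pack w = u then 1 else 0

/-- `WQSym(A)`, the span of the series `M_u(A)`. -/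
def WQSym : Submodule R (WordSeries R) := Submodule.span R (Set.range (wordM R))

variable {R}

/-- Given a relation `r` between natural numbers, the bilinear operation on series which sends a pair
of nonempty words `(x, y)` to their concatenation if `r (max x) (max y)`, and to `0` otherwise
(it is zero if `x` or `y` is empty). -/
noncomputable def partialMul (r : ℕ → ℕ → Prop) [DecidableRel r] (f g : WordSeries R) :
    WordSeries R := fun w =>
  ∑ i ∈ Finset.Ioo 0 w.length,
    if r (maxLetter (w.take i)) (maxLetter (w.drop i)) then f (w.take i) * g (w.drop i) else 0

theorem mem_WQSym_iff {f : WordSeries R} : f ∈ WQSym R ↔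
    (∀ w, f (pack w).1 = f w) ∧ ∃ N, ∀ w : List ℕ, N < w.length → f w = 0 := by
  constructor
  · intro hf
    induction hf using Submodule.span_induction with
    | mem x hx =>
      obtain ⟨u, rfl⟩ := hx
      refine ⟨fun w => by simp [wordM], u.1.length, fun w hw => ?_⟩
      have : pack w ≠ u := by
        rintro rfl
        simp [pack] at hw
      simp [wordM, this]
    | zero => exact ⟨fun _ => rfl, 0, fun _ _ => rfl⟩
    | add x y _ _ hx hy =>
      obtain ⟨h1, N1, h2⟩ := hx
      obtain ⟨h3, N2, h4⟩ := hy
      refine ⟨fun w => by simp [h1, h3], max N1 N2, fun w hw => ?_⟩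
      simp [h2 w (by omega), h4 w (by omega)]
    | smul a x _ hx =>
      obtain ⟨h1, N1, h2⟩ := hx
      exact ⟨fun w => by simp [h1], N1, fun w hw => by simp [h2 w hw]⟩
  · rintro ⟨h1, N, h2⟩
    have : f = ∑ n ∈ Finset.range (N + 1), ∑ u ∈ PW n, f u.1 • wordM R u := by
      funext w
      have hlen : (pack w).1.length = w.length := length_packList w
      simp only [Finset.sum_apply, Pi.smul_apply, wordM, smul_eq_mul, mul_ite, mul_one, mul_zero,
        Finset.sum_ite_eq, mem_PW, h1, hlen, Finset.mem_range]
      by_cases hw : w.length < N + 1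
      · rw [if_pos hw]
      · rw [if_neg hw, h2 w (by omega)]
    rw [this]
    exact Submodule.sum_mem _ fun n _ => Submodule.sum_mem _ fun u _ =>
      Submodule.smul_mem _ _ (Submodule.subset_span ⟨u, rfl⟩)

theorem le_maxLetter {w : List ℕ} {a : ℕ} (ha : a ∈ w) : a ≤ maxLetter w := by
  induction w with
  | nil => simp at ha
  | cons b w ih =>
    rcases List.mem_cons.1 ha with rfl | h
    · simp [maxLetter]
    · have := ih h
      simp only [maxLetter, List.foldr_cons] at this ⊢
      omega

theorem maxLetter_mem {w : List ℕ} (hw : w ≠ []) : maxLetter w ∈ w := by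
  induction w with
  | nil => exact absurd rfl hw
  | cons b w ih =>
    by_cases h : w = []
    · subst h
      simp [maxLetter]
    · have := ih h
      simp only [maxLetter, List.foldr_cons] at this ⊢
      rcases max_choice b (w.foldr max 0) with h' | h' <;> rw [h'] <;> simp [this]

theorem maxLetter_map {w : List ℕ} (hw : w ≠ []) (f : ℕ → ℕ)
    (hf : StrictMonoOn f {a | a ∈ w}) : maxLetter (w.map f) = f (maxLetter w) := by
  apply le_antisymm
  · have h := maxLetter_mem (w := w.map f) (by simpa using hw)
    obtain ⟨a, ha, h⟩ := List.mem_map.1 h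
    rw [← h]
    exact (hf.le_iff_le ha (maxLetter_mem hw)).2 (le_maxLetter ha)
  · exact le_maxLetter (List.mem_map_of_mem (maxLetter_mem hw))

theorem partialMul_mem (r : ℕ → ℕ → Prop) [DecidableRel r]
    (hr : ∀ (s : Set ℕ) (φ : ℕ → ℕ), StrictMonoOn φ s → ∀ a ∈ s, ∀ b ∈ s, r (φ a) (φ b) ↔ r a b)
    {f g : WordSeries R} (hf : f ∈ WQSym R) (hg : g ∈ WQSym R) :
    partialMul r f g ∈ WQSym R := by
  obtain ⟨hf1, N1, hf2⟩ := mem_WQSym_iff.1 hf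
  obtain ⟨hg1, N2, hg2⟩ := mem_WQSym_iff.1 hg
  refine mem_WQSym_iff.2 ⟨fun w => ?_, N1 + N2, fun w hw => ?_⟩
  · have hmono := rank_strictMonoOn w
    have hsub1 : ∀ i, StrictMonoOn (rank w) {a | a ∈ w.take i} := fun i =>
      hmono.mono fun a ha => List.mem_of_mem_take ha
    have hsub2 : ∀ i, StrictMonoOn (rank w) {a | a ∈ w.drop i} := fun i =>
      hmono.mono fun a ha => List.mem_of_mem_drop ha
    have hp : ∀ (h : WordSeries R), (∀ w, h (pack w).1 = h w) → ∀ x : List ℕ,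
        StrictMonoOn (rank w) {a | a ∈ x} → h (x.map (rank w)) = h x := by
      intro h hh x hx
      rw [← hh (x.map (rank w)), ← hh x]
      simp only [pack, packList_map _ _ hx]
    simp only [partialMul, pack, length_packList]
    refine Finset.sum_congr rfl fun i hi => ?_
    rw [Finset.mem_Ioo] at hi
    have hn1 : w.take i ≠ [] := by
      intro h
      have := congrArg List.length h
      rw [List.length_take, List.length_nil] at this
      omega
    have hn2 : w.drop i ≠ [] := by
      intro h
      have := congrArg List.length h
      rw [List.length_drop, List.length_nil] at this
      omega
    simp only [packList, ← List.map_take, ← List.map_drop]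
    rw [maxLetter_map hn1 _ (hsub1 i), maxLetter_map hn2 _ (hsub2 i),
      hp f hf1 _ (hsub1 i), hp g hg1 _ (hsub2 i)]
    have := hr _ _ hmono _ (List.mem_of_mem_take (maxLetter_mem hn1)) _
      (List.mem_of_mem_drop (maxLetter_mem hn2))
    simp only [this]
  · refine Finset.sum_eq_zero fun i hi => ?_
    rw [Finset.mem_Ioo] at hi
    by_cases h : N1 < i
    · rw [hf2 (w.take i) (by rw [List.length_take]; omega)]
      simp
    · rw [hg2 (w.drop i) (by rw [List.length_drop]; omega)]
      simp

/-- The left partial product `f ≺ g` on `WQSym`: `x ≺ y = xy` if `max x > max y`, else `0`. -/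
noncomputable def prec (f g : WQSym R) : WQSym R :=
  ⟨partialMul (· > ·) f.1 g.1, partialMul_mem _ (fun _ _ h _ ha _ hb => by exact h.lt_iff_lt hb ha) f.2 g.2⟩

/-- The middle partial product on `WQSym`: `x ∘ y = xy` if `max x = max y`, else `0`. -/
noncomputable def mid (f g : WQSym R) : WQSym R :=
  ⟨partialMul (· = ·) f.1 g.1,
    partialMul_mem _ (fun _ _ h _ ha _ hb => h.injOn.eq_iff ha hb) f.2 g.2⟩

/-- The right partial product `f ≻ g` on `WQSym`: `x ≻ y = xy` if `max x < max y`, else `0`. -/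
noncomputable def succ (f g : WQSym R) : WQSym R :=
  ⟨partialMul (· < ·) f.1 g.1, partialMul_mem _ (fun _ _ h _ ha _ hb => h.lt_iff_lt ha hb) f.2 g.2⟩

theorem linearIndependent_wordM : LinearIndependent R (wordM R) := by
  rw [linearIndependent_iff]
  intro l hl
  ext u
  have := congrFun hl u.1
  rw [Finsupp.linearCombination_apply, Finsupp.sum, Finset.sum_apply] at this
  simp only [Pi.smul_apply, wordM, pack_coe, smul_eq_mul, mul_ite, mul_one, mul_zero,
    Finset.sum_ite_eq, Pi.zero_apply, Finsupp.mem_support_iff] at this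
  by_cases h : l u = 0
  · exact h
  · simp [h] at this

variable (R)

/-- The basis `(M_u)` of `WQSym`. -/
noncomputable def basisM : Module.Basis PackedWord R (WQSym R) :=
  Module.Basis.span linearIndependent_wordM

/-- The element `M_u` of `WQSym`. -/
noncomputable def M (u : PackedWord) : WQSym R :=
  ⟨wordM R u, Submodule.subset_span ⟨u, rfl⟩⟩

theorem basisM_apply (u : PackedWord) : basisM R u = M R u :=
  Module.Basis.span_apply linearIndependent_wordM u

/-! ### The graded dual, noncommutative symmetric functions and the transformation `A ↦ (1 - t)A` -/

/-- The graded dual `WQSym^*`, with basis `N_u` dual to `M_u`. -/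
abbrev WQSymDual : Type _ := PackedWord →₀ R

/-- The basis element `N_u` of the graded dual. -/
noncomputable def N (u : PackedWord) : WQSymDual R := Finsupp.single u 1

/-- The duality pairing, for which `⟨M_u, N_v⟩ = δ_{u,v}`. -/
noncomputable def pairing : WQSym R →ₗ[R] WQSymDual R →ₗ[R] R :=
  (basisM R).constr R fun u => Finsupp.lapply u

/-- The packed word of the biword with rows `u` and `v`, biletters being ordered
lexicographically. -/
def packPair (u v : PackedWord) : PackedWord :=
  pack (List.zipWith (fun a b => toLex (a, b)) u.1 v.1)

variable {R} in
/-- The internal product of `WQSym^*`: `N_u * N_v = N_{pack(u,v)}` if `u` and `v` have the same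
length, and `0` otherwise. -/
noncomputable def internalMul (f g : WQSymDual R) : WQSymDual R :=
  f.sum fun u a => g.sum fun v b =>
    if u.1.length = v.1.length then (a * b) • N R (packPair u v) else 0

/-- The algebra `Sym` of noncommutative symmetric functions: the free associative algebra on
`S_1, S_2, …`; the word `i_1 ⋯ i_r` stands for `S^I = S_{i_1} ⋯ S_{i_r}`. -/
abbrev NSym : Type _ := MonoidAlgebra R (FreeMonoid ℕ+)

/-- The complete function `S_n`, with `S_0 = 1`. -/
noncomputable def completeS (n : ℕ) : NSym R :=
  if h : 0 < n then MonoidAlgebra.of R (FreeMonoid ℕ+) (FreeMonoid.of ⟨n, h⟩) else 1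

/-- The elementary function `Λ_n = ∑_{I ⊨ n} (-1)^{n - ℓ(I)} S^I`. -/
noncomputable def elementaryL (n : ℕ) : NSym R :=
  ∑ I : Composition n, (-1 : R) ^ (n - I.length) • (I.blocks.map (completeS R)).prod

variable {R} in
/-- The component of degree `n` of `σ_1((1-t)A) = λ_{-t}(A) σ_1(A)`, where
`λ_{-t}(A) = ∑_k (-t)^k Λ_k` and `σ_1(A) = ∑_k S_k`. -/
noncomputable def sigmaOneSub (t : R) (n : ℕ) : NSym R :=
  ∑ k ∈ Finset.range (n + 1), (-t) ^ k • (elementaryL R k * completeS R (n - k))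

/-- The embedding of `Sym` into `WQSym^*`, `S^I ↦ ∑_{ev(u) = I} N_u`. -/
noncomputable def symEmbed (x : NSym R) : WQSymDual R :=
  x.coeff.sum fun I c =>
    c • ∑ u ∈ (PW ((I.toList.map PNat.val).sum)).filter (fun u => ev u = I.toList.map PNat.val),
      N R u

variable {R}

/-- The linear map `η_t` of `WQSym^*`, `N_u ↦ N_u((1-t)A) = N_u * σ_1((1-t)A)` (only the component
of degree `|u|` of the right factor contributes). -/
noncomputable def eta (t : R) : WQSymDual R →ₗ[R] WQSymDual R :=
  Finsupp.linearCombination R fun u => internalMul (N R u) (symEmbed R (sigmaOneSub t u.1.length))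

/-- The adjoint `η_t^*` of `η_t`, `M_w ↦ M_w(A · (1-t))`. -/
noncomputable def etaStar (t : R) : WQSym R →ₗ[R] WQSym R :=
  (basisM R).constr R fun w => ∑ u ∈ PW w.1.length, eta t (N R u) w • M R u

theorem internalMul_apply_eq_zero (u w : PackedWord) (g : WQSymDual R)
    (h : w.1.length ≠ u.1.length) : internalMul (N R u) g w = 0 := by
  rw [internalMul, N, Finsupp.sum_single_index (by simp), Finsupp.sum, Finsupp.finsetSum_apply]
  refine Finset.sum_eq_zero fun v _ => ?_
  split_ifs with hl
  · have : packPair u v ≠ w := by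
      rintro rfl
      apply h
      simp [packPair, pack, hl]
    simp [N, this]
  · rfl

/-- `η_t^*` is the adjoint of `η_t` for the duality pairing. -/
theorem pairing_etaStar (t : R) (f : WQSym R) (g : WQSymDual R) :
    pairing R (etaStar t f) g = pairing R f (eta t g) := by
  suffices h : pairing R ∘ₗ etaStar t = (pairing R).compl₂ (eta t) by
    simpa using LinearMap.congr_fun₂ h f g
  refine (basisM R).ext fun w => Finsupp.lhom_ext' fun u => LinearMap.ext_ring ?_
  simp only [LinearMap.comp_apply, LinearMap.compl₂_apply, etaStar, Module.Basis.constr_basis,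
    map_sum, map_smul, LinearMap.sum_apply, LinearMap.smul_apply, pairing, ← basisM_apply,
    Finsupp.lapply_apply, Finsupp.lsingle_apply, smul_eq_mul]
  simp only [Finsupp.single_apply, mul_ite, mul_one, mul_zero, Finset.sum_ite_eq, mem_PW]
  split_ifs with h
  · rfl
  · simp only [eta, Finsupp.linearCombination_single, one_smul]
    exact (internalMul_apply_eq_zero u w _ (Ne.symm h)).symm

/-! ### The specialization at `𝕏` -/

/-- `M_u(1/(1-q))`, as a power series in `q`: the value of the series `M_u(A)` when `A` is the
alphabet `{⋯ < q² < q < 1}` of commuting letters. A word over this alphabet is encoded by the list of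
the exponents of its letters, which are compared in the reverse order. -/
noncomputable def principalM (u : PackedWord) : R⟦X⟧ :=
  PowerSeries.mk fun d =>
    (Nat.card {w : List ℕ // pack (w.map OrderDual.toDual) = u ∧ w.sum = d} : R)

/-- The specialization `f ↦ f(1/(1-q))` of `WQSym`. -/
noncomputable def principal : WQSym R →ₗ[R] R⟦X⟧ :=
  (basisM R).constr R principalM

end WQSymDefs

section Specialization

variable (K : Type*) [Field K]

/-- The indeterminate `t`, in the field `K(t)((q))`. -/
noncomputable def t : (RatFunc K)⸨X⸩ := HahnSeries.C RatFunc.X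

/-- The indeterminate `q`, in the field `K(t)((q))`. -/
noncomputable def q : (RatFunc K)⸨X⸩ := ((PowerSeries.X : (RatFunc K)⟦X⟧) : (RatFunc K)⸨X⸩)

variable {K}

/-- The specialization `f ↦ f(𝕏)` of `WQSym` at `𝕏 = 1/(1-q) ×̂ (1-t)`: apply `A ↦ A · (1-t)`,
then set `A = 1/(1-q)`. -/
noncomputable def atX (f : WQSym (RatFunc K)) : (RatFunc K)⸨X⸩ :=
  ((principal (etaStar RatFunc.X f) : (RatFunc K)⟦X⟧) : (RatFunc K)⸨X⸩)

end Specialization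

end WordQSym

/-!
A word over `1/(1-q)` that contributes to `M_w(𝕏)` replaces the letters of `w` by powers of `q`
whose exponents weakly decrease. Its coefficient is a signed sum over the packed words that strictly
increase along the letters sharing an exponent; it collapses to the product, over the letters `a` of
`w` with `c` occurrences, of `1 - t^c` if `a` is the greatest letter with its exponent and of `-t^c`
otherwise. Summing geometric series over the drops of the exponents gives
`M_w(𝕏) = (1 - t^s) / (1 - q^n) * ∏ (q^N - t^c) / (1 - q^N)`, where `n` is the length of `w`,
`s = Nmax w`, and the product runs over the non-maximal letters `a`, with `N` the number of letters
of `w` that are at most `a`.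

The words of `M_{u₁} M_{u₂}` are the strictly monotone images of the concatenation `u₁u₂`, whose
alphabet is the disjoint union of two chains. They correspond to the layerings of this poset, and
summing the products above over the layerings of a forest gives the product of the factors
`(q^N - t^c) / (1 - q^N)` over its elements, `N` being the size of the hook below an element. The
operations `≺`, `∘`, `≻` prescribe the highest layer: the maximal letter of `u₁`, of both, of `u₂`.
Hence the three values differ only by the factor of the highest layer and by the factors of the
maximal letters that remain below it.
-/

namespace WordQSym

/-! ### Layerings of finite posets -/

section Layers

variable {ι : Type*}

/-- The ordered set partition, listed from top to bottom, of the elements of `T` on which `f` takes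
the values `1, …, p`. -/
def layers (T : Finset ι) (f : ι → ℕ) : ℕ → List (Finset ι)
  | 0 => []
  | p + 1 => {i ∈ T | f i = p + 1} :: layers T f p

theorem length_layers (T : Finset ι) (f : ι → ℕ) (p : ℕ) : (layers T f p).length = p := by
  induction p with
  | zero => rfl
  | succ p ih => rw [layers, List.length_cons, ih]

theorem layers_congr {T T' : Finset ι} {f f' : ι → ℕ} {p : ℕ}
    (h : ∀ k, 0 < k → k ≤ p → ∀ i, (i ∈ T ∧ f i = k ↔ i ∈ T' ∧ f' i = k)) :
    layers T f p = layers T' f' p := by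
  induction p with
  | zero => rfl
  | succ p ih =>
    rw [layers, layers, ih fun k hk hkp => h k hk (hkp.trans p.le_succ)]
    congr 1
    ext i
    simpa using h (p + 1) p.succ_pos le_rfl i

variable [DecidableEq ι]

/-- The level of `i` in an ordered set partition listed from top to bottom, the lowest block having
level `1`; it is `0` if `i` belongs to no block. -/
def height : List (Finset ι) → ι → ℕ
  | [], _ => 0
  | S :: L, i => if i ∈ S then L.length + 1 else height L i

theorem height_le_length (L : List (Finset ι)) (i : ι) : height L i ≤ L.length := by
  induction L with
  | nil => simp [height]
  | cons S L ih =>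
    rw [height, List.length_cons]
    split_ifs
    · exact le_rfl
    · exact ih.trans L.length.le_succ

theorem height_cons_of_mem {S : Finset ι} {i : ι} (L : List (Finset ι)) (hi : i ∈ S) :
    height (S :: L) i = L.length + 1 := if_pos hi

theorem height_cons_of_notMem {S : Finset ι} {i : ι} (L : List (Finset ι)) (hi : i ∉ S) :
    height (S :: L) i = height L i := if_neg hi

theorem height_cons_eq_length_iff {S : Finset ι} {L : List (Finset ι)} {i : ι} :
    height (S :: L) i = L.length + 1 ↔ i ∈ S := by
  refine ⟨fun h => ?_, height_cons_of_mem L⟩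
  by_contra hi
  have := height_le_length L i
  rw [height_cons_of_notMem L hi] at h
  omega

theorem height_cons_lt_height_cons_iff {S : Finset ι} {L : List (Finset ι)} {i j : ι}
    (h : i ∈ S ∨ j ∈ S) : height (S :: L) i < height (S :: L) j ↔ i ∉ S := by
  rw [← height_cons_eq_length_iff (L := L), ← height_cons_eq_length_iff (L := L)] at h
  rw [← height_cons_eq_length_iff (L := L)]
  have hi := height_le_length (S :: L) i
  have hj := height_le_length (S :: L) j
  rw [List.length_cons] at hi hj
  omega

theorem height_cons_eq_height_cons_iff {S : Finset ι} {L : List (Finset ι)} {i j : ι}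
    (h : i ∈ S ∨ j ∈ S) : height (S :: L) i = height (S :: L) j ↔ i ∈ S ∧ j ∈ S := by
  rw [← height_cons_eq_length_iff (L := L), ← height_cons_eq_length_iff (L := L)] at h ⊢
  omega

theorem height_layers {T : Finset ι} {f : ι → ℕ} {p : ℕ} {i : ι} (hi : i ∈ T) (hp : f i ≤ p) :
    height (layers T f p) i = f i := by
  induction p with
  | zero => exact (Nat.le_zero.1 hp).symm
  | succ p ih =>
    rcases hp.eq_or_lt with h | h
    · rw [layers, height_cons_of_mem _ (by simp [hi, h]), length_layers, h]
    · rw [layers, height_cons_of_notMem _ (by simp [h.ne]), ih (Nat.lt_succ_iff.1 h)]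

end Layers

section Layerings

variable {ι : Type*} [Preorder ι]

open scoped Classical in
/-- The maximal elements of a finite subset `T` of a poset. -/
noncomputable def maximals (T : Finset ι) : Finset ι := {i ∈ T | Maximal (· ∈ T) i}

@[simp] theorem mem_maximals {T : Finset ι} {i : ι} : i ∈ maximals T ↔ Maximal (· ∈ T) i := by
  classical
  rw [maximals, Finset.mem_filter]
  exact and_iff_right_of_imp Maximal.prop

theorem maximals_subset (T : Finset ι) : maximals T ⊆ T :=
  fun _ hi => (mem_maximals.1 hi).prop

theorem maximals_disjSum {κ : Type*} [Preorder κ] (A : Finset ι) (B : Finset κ) :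
    maximals (A.disjSum B) = (maximals A).disjSum (maximals B) := by
  ext (i | i) <;> simp [Maximal]

theorem maximals_nonempty {T : Finset ι} (hT : T.Nonempty) : (maximals T).Nonempty :=
  let ⟨i, hi⟩ := T.exists_maximal hT
  ⟨i, mem_maximals.2 hi⟩

variable [DecidableEq ι]

/-- A layering of a finite subset `T` of a poset is an ordered set partition of `T`, listed from its
highest block to its lowest one, for which the map sending an element to its level is strictly
monotone: each block consists of maximal elements of what the blocks above it leave. -/
inductive IsLayering : Finset ι → List (Finset ι) → Prop
  | nil : IsLayering ∅ []
  | cons {T S : Finset ι} {L : List (Finset ι)} (hne : S.Nonempty) (hS : S ⊆ maximals T)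
      (hL : IsLayering (T \ S) L) : IsLayering T (S :: L)

theorem sdiff_ssubset_of_subset_maximals {T S : Finset ι} (hS : S ⊆ maximals T)
    (hne : S.Nonempty) : T \ S ⊂ T :=
  Finset.sdiff_ssubset (hS.trans (maximals_subset T)) hne

@[simp] theorem isLayering_empty_iff {L : List (Finset ι)} : IsLayering ∅ L ↔ L = [] := by
  refine ⟨fun h => ?_, fun h => h ▸ .nil⟩
  cases h with
  | nil => rfl
  | cons hne hS => exact absurd (hne.mono (hS.trans (maximals_subset ∅))) Finset.not_nonempty_empty

theorem IsLayering.exists_eq_cons {T : Finset ι} {L : List (Finset ι)} (h : IsLayering T L)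
    (hT : T.Nonempty) : ∃ S L', S.Nonempty ∧ S ⊆ maximals T ∧ IsLayering (T \ S) L' ∧
      L = S :: L' := by
  cases h with
  | nil => exact absurd hT Finset.not_nonempty_empty
  | cons hne hS hL => exact ⟨_, _, hne, hS, hL, rfl⟩

theorem IsLayering.head_subset {T S : Finset ι} {L : List (Finset ι)}
    (h : IsLayering T (S :: L)) : S ⊆ T := by
  cases h with
  | cons _ hS _ => exact hS.trans (maximals_subset T)

theorem finite_isLayering (T : Finset ι) : {L | IsLayering T L}.Finite := by
  induction T using Finset.strongInduction with
  | H T ih =>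
    rcases T.eq_empty_or_nonempty with rfl | hT
    · simp
    refine (((maximals T).powerset.erase ∅).finite_toSet.biUnion (t := fun S =>
      (S :: ·) '' {L | IsLayering (T \ S) L}) fun S hS => (ih _ ?_).image _).subset ?_
    · rw [Finset.mem_coe, Finset.mem_erase, Finset.mem_powerset,
        ← Finset.nonempty_iff_ne_empty] at hS
      exact sdiff_ssubset_of_subset_maximals hS.2 hS.1
    · intro L hL
      obtain ⟨S, tail, hne, hS, htail, rfl⟩ := IsLayering.exists_eq_cons hL hT
      exact Set.mem_biUnion (Finset.mem_erase.2 ⟨hne.ne_empty, Finset.mem_powerset.2 hS⟩)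
        ⟨tail, htail, rfl⟩

/-- The finite set of layerings of `T`. -/
noncomputable def layerings (T : Finset ι) : Finset (List (Finset ι)) :=
  (finite_isLayering T).toFinset

@[simp] theorem mem_layerings {T : Finset ι} {L : List (Finset ι)} :
    L ∈ layerings T ↔ IsLayering T L := by
  simp [layerings]

@[simp] theorem layerings_empty : layerings (∅ : Finset ι) = {[]} := by
  ext L
  simp

theorem sum_layerings {R : Type*} [AddCommMonoid R] {T : Finset ι} (hT : T.Nonempty)
    (Φ : List (Finset ι) → R) :
    ∑ L ∈ layerings T, Φ L =
      ∑ S ∈ (maximals T).powerset.erase ∅, ∑ L ∈ layerings (T \ S), Φ (S :: L) := by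
  rw [Finset.sum_sigma']
  refine (Finset.sum_bij (fun x _ => x.1 :: x.2) ?_ ?_ ?_ fun _ _ => rfl).symm
  · rintro ⟨S, L⟩ h
    simp only [Finset.mem_sigma, Finset.mem_erase, Finset.mem_powerset, mem_layerings,
      ← Finset.nonempty_iff_ne_empty] at h ⊢
    exact .cons h.1.1 h.1.2 h.2
  · rintro ⟨S, L⟩ _ ⟨S', L'⟩ _ h
    obtain ⟨rfl, rfl⟩ := List.cons.inj h
    rfl
  · intro L hL
    obtain ⟨S, L', hne, hS, hL', rfl⟩ := (mem_layerings.1 hL).exists_eq_cons hT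
    refine ⟨⟨S, L'⟩, Finset.mem_sigma.2 ⟨Finset.mem_erase.2 ⟨hne.ne_empty, ?_⟩, ?_⟩, rfl⟩
    · exact Finset.mem_powerset.2 hS
    · exact mem_layerings.2 hL'

theorem IsLayering.height_pos {T : Finset ι} {L : List (Finset ι)} (h : IsLayering T L) {i : ι}
    (hi : i ∈ T) : 0 < height L i := by
  induction h with
  | nil => simp at hi
  | @cons T S L _ _ _ ih =>
    by_cases hiS : i ∈ S
    · simp [height_cons_of_mem L hiS]
    · rw [height_cons_of_notMem L hiS]
      exact ih (Finset.mem_sdiff.2 ⟨hi, hiS⟩)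

theorem IsLayering.exists_height_eq {T : Finset ι} {L : List (Finset ι)} (h : IsLayering T L)
    {k : ℕ} (hk : 0 < k) (hkL : k ≤ L.length) : ∃ i ∈ T, height L i = k := by
  induction h with
  | nil => simp only [List.length_nil] at hkL; omega
  | @cons T S L hne hS _ ih =>
    rw [List.length_cons] at hkL
    rcases hkL.eq_or_lt with rfl | hlt
    · obtain ⟨i, hi⟩ := hne
      exact ⟨i, maximals_subset T (hS hi), height_cons_of_mem L hi⟩
    · obtain ⟨i, hi, rfl⟩ := ih (Nat.lt_succ_iff.1 hlt)
      rw [Finset.mem_sdiff] at hi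
      exact ⟨i, hi.1, height_cons_of_notMem L hi.2⟩

theorem IsLayering.strictMonoOn_height {T : Finset ι} {L : List (Finset ι)}
    (h : IsLayering T L) : StrictMonoOn (height L) T := by
  induction h with
  | nil => simp [StrictMonoOn]
  | @cons T S L _ hS _ ih =>
    intro i hi j hj hij
    have hiS : i ∉ S := fun hiS => hij.not_ge ((mem_maximals.1 (hS hiS)).2 hj hij.le)
    rw [height_cons_of_notMem L hiS]
    by_cases hjS : j ∈ S
    · rw [height_cons_of_mem L hjS]
      exact Nat.lt_succ_of_le (height_le_length L i)
    · rw [height_cons_of_notMem L hjS]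
      exact ih (by simp_all) (by simp_all) hij

theorem IsLayering.layers_height {T : Finset ι} {L : List (Finset ι)} (h : IsLayering T L) :
    layers T (height L) L.length = L := by
  induction h with
  | nil => rfl
  | @cons T S L _ hS _ ih =>
    rw [List.length_cons, layers]
    congr 1
    · ext i
      rw [Finset.mem_filter, height_cons_eq_length_iff]
      exact ⟨fun hi => hi.2, fun hi => ⟨maximals_subset T (hS hi), hi⟩⟩
    · refine (layers_congr fun k _ hkL i => ?_).trans ih
      by_cases hi : i ∈ S
      · simp only [height_cons_of_mem L hi, Finset.mem_sdiff, hi, not_true_eq_false, and_false,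
          false_and, iff_false, not_and]
        omega
      · simp [height_cons_of_notMem L hi, hi]

theorem isLayering_layers {T : Finset ι} {f : ι → ℕ} {p : ℕ} (hf : StrictMonoOn f T)
    (hpos : ∀ i ∈ T, 0 < f i) (hsurj : ∀ k, 0 < k → k ≤ p → ∃ i ∈ T, f i = k) :
    IsLayering {i ∈ T | f i ≤ p} (layers T f p) := by
  induction p with
  | zero =>
    rw [layers, Finset.filter_false_of_mem fun i hi => not_le.2 (hpos i hi)]
    exact .nil
  | succ p ih =>
    refine .cons ?_ ?_ ?_
    · obtain ⟨i, hi, hfi⟩ := hsurj (p + 1) p.succ_pos le_rfl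
      exact ⟨i, by simp [hi, hfi]⟩
    · intro i hi
      rw [Finset.mem_filter] at hi
      refine mem_maximals.2 ⟨by simp [hi.1, hi.2], fun j hj hij => ?_⟩
      obtain ⟨hj, hfj⟩ := Finset.mem_filter.1 hj
      by_contra hji
      exact (hf hi.1 hj (lt_of_le_not_ge hij hji)).not_ge (hfj.trans_eq hi.2.symm)
    · convert ih fun k hk hkp => hsurj k hk (hkp.trans p.le_succ) using 1
      grind

end Layerings

/-! ### Sums over layerings -/

section LayeringSums

/-- The list of the sums of `a` over the blocks of `L`. -/
def blockSums {ι : Type*} (a : ι → ℕ) (L : List (Finset ι)) : List ℕ :=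
  L.map fun S => ∑ i ∈ S, a i

/-- The coefficient of `N_v` in `σ₁((1-t)A)`, as a function of the evaluation of `v` read from its
last part to its first one. -/
def sigmaCoeff {R : Type*} [CommRing R] (t : R) : List ℕ → R
  | [] => 1
  | s :: L => (-1) ^ L.length * t ^ L.sum * (1 - t ^ s)

/-- The factor `(q ^ N - t ^ s) / (1 - q ^ N)` of a hook of size `N` with `s` letters at its top. -/
def hookFactor {F : Type*} [Field F] (q t : F) (N s : ℕ) : F := (q ^ N - t ^ s) / (1 - q ^ N)

/-- The product of the hook factors of a chain whose sizes are listed from top to bottom. -/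
def chainProd {F : Type*} [Field F] (q t : F) : List ℕ → F
  | [] => 1
  | s :: L => hookFactor q t (s + L.sum) s * chainProd q t L

/-- The total size of the elements of `T` lying below `i`. -/
noncomputable def hook {ι : Type*} [Preorder ι] (a : ι → ℕ) (T : Finset ι) (i : ι) : ℕ :=
  open scoped Classical in ∑ j ∈ T with j ≤ i, a j

/-- A finite subset `T` of a poset is a forest if any two of its elements lying above a common
element of `T` are comparable. -/
def IsForest {ι : Type*} [Preorder ι] (T : Finset ι) : Prop :=
  ∀ i ∈ T, ∀ j ∈ T, ∀ k ∈ T, k ≤ i → k ≤ j → i ≤ j ∨ j ≤ i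

section Forest

variable {ι κ : Type*}

theorem isForest_of_linearOrder [LinearOrder ι] (T : Finset ι) : IsForest T :=
  fun i _ j _ _ _ _ _ => le_total i j

variable [Preorder ι] [Preorder κ]

theorem IsForest.mono {S T : Finset ι} (hT : IsForest T) (hST : S ⊆ T) : IsForest S :=
  fun i hi j hj k hk => hT i (hST hi) j (hST hj) k (hST hk)

theorem IsForest.disjSum {A : Finset ι} {B : Finset κ} (hA : IsForest A) (hB : IsForest B) :
    IsForest (A.disjSum B) := by
  rintro (i | i) hi (j | j) hj (k | k) hk hki hkj <;>
    simp only [Finset.inl_mem_disjSum, Finset.inr_mem_disjSum, Sum.inl_le_inl_iff,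
      Sum.inr_le_inr_iff, Sum.not_inl_le_inr, Sum.not_inr_le_inl] at *
  · exact hA i hi j hj k hk hki hkj
  · exact hB i hi j hj k hk hki hkj

end Forest

section HookSize

variable {ι κ : Type*} [Preorder ι] [Preorder κ]

theorem hook_of_forall_le (a : ι → ℕ) {T : Finset ι} {i : ι} (hi : ∀ j ∈ T, j ≤ i) :
    hook a T i = ∑ j ∈ T, a j := by
  classical
  rw [hook, Finset.filter_true_of_mem hi]

theorem hook_disjSum_inl (a : ι ⊕ κ → ℕ) (A : Finset ι) (B : Finset κ) (i : ι) :
    hook a (A.disjSum B) (Sum.inl i) = hook (a ∘ Sum.inl) A i := by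
  classical
  simp [hook, Finset.sum_filter, Finset.sum_disjSum]

theorem hook_disjSum_inr (a : ι ⊕ κ → ℕ) (A : Finset ι) (B : Finset κ) (i : κ) :
    hook a (A.disjSum B) (Sum.inr i) = hook (a ∘ Sum.inr) B i := by
  classical
  simp [hook, Finset.sum_filter, Finset.sum_disjSum]

theorem le_hook (a : ι → ℕ) {T : Finset ι} {i : ι} (hi : i ∈ T) : a i ≤ hook a T i := by
  classical
  exact Finset.single_le_sum (fun _ _ => Nat.zero_le _) (by simp [hi])

end HookSize

section CommRing

variable {ι R : Type*} [DecidableEq ι] [CommRing R]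

theorem sum_nonempty_subsets_prod_mul_prod_sdiff {T U : Finset ι} (hU : U ⊆ T) (f g : ι → R) :
    ∑ S ∈ U.powerset.erase ∅, (∏ i ∈ S, f i) * ∏ i ∈ T \ S, g i =
      (∏ i ∈ U, (f i + g i)) * ∏ i ∈ T \ U, g i - ∏ i ∈ T, g i := by
  rw [Finset.sum_erase_eq_sub (by simp), Finset.prod_empty, one_mul, Finset.sdiff_empty,
    Finset.prod_add, Finset.sum_mul]
  congr 1
  refine Finset.sum_congr rfl fun S hS => ?_
  rw [mul_assoc, ← Finset.prod_union (Finset.disjoint_sdiff.mono_left Finset.sdiff_subset),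
    Finset.union_comm, Finset.sdiff_union_sdiff_cancel hU (Finset.mem_powerset.1 hS)]

variable [Preorder ι]

theorem IsLayering.sum_blockSums {T : Finset ι} {L : List (Finset ι)} (h : IsLayering T L)
    (a : ι → ℕ) : (blockSums a L).sum = ∑ i ∈ T, a i := by
  induction h with
  | nil => rfl
  | cons hne hS hL ih =>
    rw [blockSums, List.map_cons, List.sum_cons, ← blockSums, ih, add_comm,
      Finset.sum_sdiff (hS.trans (maximals_subset _))]

theorem sum_layerings_neg_one_pow_length (T : Finset ι) :
    ∑ L ∈ layerings T, (-1 : R) ^ L.length = ∏ _i ∈ T, (-1 : R) := by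
  induction T using Finset.strongInduction with
  | H T ih =>
    rcases T.eq_empty_or_nonempty with rfl | hT
    · simp
    have hblock : ∀ S ∈ (maximals T).powerset.erase ∅,
        ∑ L ∈ layerings (T \ S), (-1 : R) ^ (S :: L).length =
          -((∏ _i ∈ S, (1 : R)) * ∏ _i ∈ T \ S, (-1 : R)) := by
      intro S hS
      rw [Finset.mem_erase, Finset.mem_powerset, ← Finset.nonempty_iff_ne_empty] at hS
      simp only [List.length_cons, pow_succ]
      rw [← Finset.sum_mul, ih _ (sdiff_ssubset_of_subset_maximals hS.2 hS.1),
        Finset.prod_const_one]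
      ring
    have hzero : ∏ _i ∈ maximals T, (1 + -1 : R) = 0 := by
      simp [(maximals_nonempty hT).card_pos.ne']
    rw [sum_layerings hT, Finset.sum_congr rfl hblock, Finset.sum_neg_distrib,
      sum_nonempty_subsets_prod_mul_prod_sdiff (maximals_subset T), hzero]
    ring

theorem sum_layerings_sigmaCoeff (t : R) (a : ι → ℕ) {T : Finset ι} (hT : T.Nonempty) :
    ∑ L ∈ layerings T, sigmaCoeff t (blockSums a L) =
      (∏ i ∈ maximals T, (1 - t ^ a i)) * ∏ i ∈ T \ maximals T, -t ^ a i := by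
  have hblock : ∀ S ∈ (maximals T).powerset.erase ∅,
      ∑ L ∈ layerings (T \ S), sigmaCoeff t (blockSums a (S :: L)) =
        (∏ _i ∈ S, (1 : R)) * (∏ i ∈ T \ S, -t ^ a i) -
          (∏ i ∈ S, t ^ a i) * ∏ i ∈ T \ S, -t ^ a i := by
    intro S _
    have hterm : ∀ L ∈ layerings (T \ S), sigmaCoeff t (blockSums a (S :: L)) =
        (-1) ^ L.length * (t ^ (∑ i ∈ T \ S, a i) * (1 - t ^ ∑ i ∈ S, a i)) := by
      intro L hL
      rw [← (mem_layerings.1 hL).sum_blockSums a, ← mul_assoc]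
      simp only [blockSums, List.map_cons, sigmaCoeff, List.length_map]
    rw [Finset.sum_congr rfl hterm, ← Finset.sum_mul, sum_layerings_neg_one_pow_length,
      ← Finset.prod_pow_eq_pow_sum, ← Finset.prod_pow_eq_pow_sum, ← mul_assoc,
      ← Finset.prod_mul_distrib, Finset.prod_const_one]
    simp only [neg_one_mul]
    ring
  have hzero : ∏ i ∈ maximals T, (t ^ a i + -t ^ a i) = 0 := by
    obtain ⟨i, hi⟩ := maximals_nonempty hT
    exact Finset.prod_eq_zero hi (add_neg_cancel _)
  rw [sum_layerings hT, Finset.sum_congr rfl hblock, Finset.sum_sub_distrib,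
    sum_nonempty_subsets_prod_mul_prod_sdiff (maximals_subset T),
    sum_nonempty_subsets_prod_mul_prod_sdiff (maximals_subset T), hzero]
  simp only [sub_eq_add_neg]
  ring

end CommRing

section Hook

variable {ι F : Type*} [PartialOrder ι] [Field F]

theorem sum_hook_maximals (a : ι → ℕ) {T : Finset ι} (hT : IsForest T) :
    ∑ i ∈ maximals T, hook a T i = ∑ i ∈ T, a i := by
  classical
  simp only [hook]
  rw [Finset.sum_comm' (t' := T) (s' := fun k => {i ∈ maximals T | k ≤ i}) (by grind)]
  refine Finset.sum_congr rfl fun k hk => ?_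
  obtain ⟨i, hki, hi⟩ := T.exists_le_maximal hk
  have huniq : {j ∈ maximals T | k ≤ j} = {i} := by
    ext j
    rw [Finset.mem_filter, mem_maximals, Finset.mem_singleton]
    refine ⟨fun ⟨hj, hkj⟩ => ?_, fun h => h ▸ ⟨hi, hki⟩⟩
    rcases hT i hi.prop j hj.prop k hk hki hkj with hij | hji
    · exact (hi.eq_of_le hj.prop hij).symm
    · exact hj.eq_of_le hi.prop hji
  rw [huniq, Finset.sum_singleton]

theorem pow_sum_mul_prod_one_add_hookFactor {q : F} (hq : ∀ N, 0 < N → 1 - q ^ N ≠ 0) (t : F)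
    {a : ι → ℕ} {T : Finset ι} (ha : ∀ i ∈ T, 0 < a i) (hT : IsForest T) :
    q ^ (∑ i ∈ T, a i) * ∏ i ∈ maximals T, (1 + hookFactor q t (hook a T i) (a i)) =
      ∏ i ∈ maximals T, (t ^ a i + hookFactor q t (hook a T i) (a i)) := by
  rw [← sum_hook_maximals a hT, ← Finset.prod_pow_eq_pow_sum, ← Finset.prod_mul_distrib]
  refine Finset.prod_congr rfl fun i hi => ?_
  have hi := maximals_subset T hi
  have hqi := hq _ ((ha i hi).trans_le (le_hook a hi))
  rw [hookFactor]
  field_simp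
  ring

variable [DecidableEq ι]

theorem hook_sdiff (a : ι → ℕ) {T S : Finset ι} (hS : S ⊆ maximals T) {i : ι} (hi : i ∈ T \ S) :
    hook a (T \ S) i = hook a T i := by
  classical
  rw [Finset.mem_sdiff] at hi
  refine Finset.sum_congr (Finset.ext fun j => ?_) fun _ _ => rfl
  simp only [Finset.mem_filter, Finset.mem_sdiff]
  refine ⟨fun h => ⟨h.1.1, h.2⟩, fun h => ⟨⟨h.1, fun hj => hi.2 ?_⟩, h.2⟩⟩
  rwa [← (mem_maximals.1 (hS hj)).eq_of_le hi.1 h.2]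

theorem sum_layerings_chainProd {q : F} (hq : ∀ N, 0 < N → 1 - q ^ N ≠ 0) (t : F) {a : ι → ℕ}
    {T : Finset ι} (ha : ∀ i ∈ T, 0 < a i) (hT : IsForest T) :
    ∑ L ∈ layerings T, chainProd q t (blockSums a L) =
      ∏ i ∈ T, hookFactor q t (hook a T i) (a i) := by
  induction T using Finset.strongInduction with
  | H T ih =>
    rcases T.eq_empty_or_nonempty with rfl | hne
    · simp [blockSums, chainProd]
    set n := ∑ i ∈ T, a i with hn
    set θ : ι → F := fun i => hookFactor q t (hook a T i) (a i)
    have hblock : ∀ S ∈ (maximals T).powerset.erase ∅,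
        ∑ L ∈ layerings (T \ S), chainProd q t (blockSums a (S :: L)) =
          q ^ n / (1 - q ^ n) * ((∏ _i ∈ S, 1) * ∏ i ∈ T \ S, θ i) -
            1 / (1 - q ^ n) * ((∏ i ∈ S, t ^ a i) * ∏ i ∈ T \ S, θ i) := by
      intro S hS
      rw [Finset.mem_erase, Finset.mem_powerset, ← Finset.nonempty_iff_ne_empty] at hS
      have hterm : ∀ L ∈ layerings (T \ S), chainProd q t (blockSums a (S :: L)) =
          hookFactor q t n (∑ i ∈ S, a i) * chainProd q t (blockSums a L) := by
        intro L hL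
        have hsum := (mem_layerings.1 hL).sum_blockSums a
        rw [hn, ← Finset.sum_sdiff (hS.2.trans (maximals_subset T)), ← hsum, add_comm]
        rfl
      rw [Finset.sum_congr rfl hterm, ← Finset.mul_sum,
        ih _ (sdiff_ssubset_of_subset_maximals hS.2 hS.1)
          (fun i hi => ha i (Finset.sdiff_subset hi)) (hT.mono Finset.sdiff_subset),
        Finset.prod_congr rfl fun i hi => by rw [hook_sdiff a hS.2 hi], hookFactor,
        Finset.prod_const_one, Finset.prod_pow_eq_pow_sum]
      ring
    have hprod := pow_sum_mul_prod_one_add_hookFactor hq t ha hT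
    have hn0 : 1 - q ^ n ≠ 0 := hq n (Finset.sum_pos ha hne)
    rw [sum_layerings hne, Finset.sum_congr rfl hblock, Finset.sum_sub_distrib, ← Finset.mul_sum,
      ← Finset.mul_sum, sum_nonempty_subsets_prod_mul_prod_sdiff (maximals_subset T),
      sum_nonempty_subsets_prod_mul_prod_sdiff (maximals_subset T), ← hprod]
    field_simp
    ring

end Hook

end LayeringSums

/-! ### Strictly monotone images of a word -/

section StrictImages

theorem IsPacked.mem_iff {u : List ℕ} (hu : IsPacked u) {a : ℕ} :
    a ∈ u ↔ 1 ≤ a ∧ a ≤ maxLetter u := by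
  obtain ⟨p, hp⟩ := hu
  refine ⟨fun ha => ⟨((hp a).1 ha).1, le_maxLetter ha⟩, fun ha => (hp a).2 ⟨ha.1, ?_⟩⟩
  rcases eq_or_ne u [] with rfl | hne
  · exact absurd (ha.1.trans ha.2) (by simp [maxLetter])
  · exact ha.2.trans ((hp _).1 (maxLetter_mem hne)).2

theorem IsPacked.toFinset_eq_image {w : List ℕ} (hw : IsPacked w) :
    w.toFinset = (Finset.range (maxLetter w)).image (· + 1) := by
  ext a
  simp only [List.mem_toFinset, hw.mem_iff, Finset.mem_image, Finset.mem_range]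
  exact ⟨fun h => ⟨a - 1, by omega⟩, by rintro ⟨k, hk, rfl⟩; omega⟩

@[to_additive]
theorem IsPacked.prod_toFinset {R : Type*} [CommMonoid R] {w : List ℕ} (hw : IsPacked w)
    (f : ℕ → R) : ∏ a ∈ w.toFinset, f a = ∏ k ∈ Finset.range (maxLetter w), f (k + 1) := by
  rw [hw.toFinset_eq_image, Finset.prod_image (add_left_injective 1).injOn]

theorem packList_map_of_isPacked {A : Type*} [LinearOrder A] {u : List ℕ} (hu : IsPacked u)
    {φ : ℕ → A} (hφ : StrictMonoOn φ {a | a ∈ u}) : packList (u.map φ) = u := by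
  rw [packList_map φ u hφ, packList_of_isPacked hu]

theorem exists_strictMonoOn_map_packList_eq {A : Type*} [LinearOrder A] [Nonempty A]
    (z : List A) :
    ∃ φ : ℕ → A, StrictMonoOn φ {a | a ∈ packList z} ∧ (packList z).map φ = z := by
  have hm := rank_strictMonoOn z
  set φ := Function.invFunOn (rank z) {a | a ∈ z}
  have hφ : ∀ a ∈ z, φ (rank z a) = a := fun a ha => hm.injOn.leftInvOn_invFunOn ha
  refine ⟨φ, fun k hk l hl hkl => ?_, ?_⟩
  · obtain ⟨a, ha, rfl⟩ := List.mem_map.1 hk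
    obtain ⟨b, hb, rfl⟩ := List.mem_map.1 hl
    rw [hφ a ha, hφ b hb]
    exact (hm.lt_iff_lt ha hb).1 hkl
  · rw [packList, List.map_map]
    exact (List.map_congr_left hφ).trans (List.map_id z)

variable {ι : Type*}

theorem count_map_eq_sum [DecidableEq ι] (ω : List ι) (f : ι → ℕ) (k : ℕ) :
    (ω.map f).count k = ∑ i ∈ ω.toFinset with f i = k, ω.count i := by
  rw [List.count, List.countP_map, List.countP_eq_length_filter,
    ← List.sum_toFinset_count_eq_length, List.toFinset_filter]
  refine Finset.sum_congr (by simp) fun i hi => List.count_filter ?_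
  simpa using (Finset.mem_filter.1 hi).2

theorem blockSums_layers (a : ι → ℕ) (T : Finset ι) (f : ι → ℕ) (p : ℕ) :
    blockSums a (layers T f p) =
      ((List.range p).map fun k => ∑ i ∈ T with f i = k + 1, a i).reverse := by
  induction p with
  | zero => rfl
  | succ p ih =>
    rw [layers, blockSums, List.map_cons, ← blockSums, ih, List.range_succ, List.map_append,
      List.map_singleton, List.reverse_concat]

variable [Preorder ι]

open scoped Classical in
/-- The packed words obtained from the word `ω` over a poset by substitutions that are strictly
monotone on its letters. -/
noncomputable def strictImages (ω : List ι) : Finset PackedWord :=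
  {v ∈ PW ω.length | ∃ f : ι → ℕ, StrictMonoOn f {i | i ∈ ω} ∧ ω.map f = v}

theorem mem_strictImages {ω : List ι} {v : PackedWord} :
    v ∈ strictImages ω ↔ ∃ f : ι → ℕ, StrictMonoOn f {i | i ∈ ω} ∧ ω.map f = v := by
  classical
  rw [strictImages, Finset.mem_filter, mem_PW, and_iff_right_iff_imp]
  rintro ⟨f, -, h⟩
  rw [← h, List.length_map]

variable [DecidableEq ι] {ω : List ι} {L : List (Finset ι)}

theorem IsLayering.mem_map_height_iff (h : IsLayering ω.toFinset L) {k : ℕ} :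
    k ∈ ω.map (height L) ↔ 1 ≤ k ∧ k ≤ L.length := by
  rw [List.mem_map]
  constructor
  · rintro ⟨i, hi, rfl⟩
    exact ⟨h.height_pos (List.mem_toFinset.2 hi), height_le_length L i⟩
  · rintro ⟨hk, hkL⟩
    obtain ⟨i, hi, rfl⟩ := h.exists_height_eq hk hkL
    exact ⟨i, List.mem_toFinset.1 hi, rfl⟩

/-- The packed word obtained from `ω` by substituting its level in `L` for each letter. -/
def heightWord (ω : List ι) (L : List (Finset ι)) : PackedWord := pack (ω.map (height L))

theorem IsLayering.coe_heightWord (h : IsLayering ω.toFinset L) :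
    (heightWord ω L : List ℕ) = ω.map (height L) :=
  packList_of_isPacked ⟨L.length, fun _ => h.mem_map_height_iff⟩

theorem IsLayering.maxLetter_heightWord (h : IsLayering ω.toFinset L) :
    maxLetter (heightWord ω L : List ℕ) = L.length := by
  have hmem (k : ℕ) :
      (1 ≤ k ∧ k ≤ maxLetter (heightWord ω L : List ℕ)) ↔ 1 ≤ k ∧ k ≤ L.length := by
    rw [← (heightWord ω L).2.mem_iff, h.coe_heightWord, h.mem_map_height_iff]
  have h₁ := hmem L.length
  have h₂ := hmem (maxLetter (heightWord ω L : List ℕ))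
  omega

theorem IsLayering.reverse_ev_heightWord (h : IsLayering ω.toFinset L) :
    (ev (heightWord ω L)).reverse = blockSums ω.count L := by
  rw [ev, h.maxLetter_heightWord, h.coe_heightWord]
  simp only [count_map_eq_sum]
  rw [← blockSums_layers, h.layers_height]

theorem IsLayering.Nmax_heightWord {S : Finset ι} (h : IsLayering ω.toFinset (S :: L)) :
    Nmax (heightWord ω (S :: L) : List ℕ) = ∑ i ∈ S, ω.count i := by
  rw [Nmax, h.maxLetter_heightWord, h.coe_heightWord, count_map_eq_sum]
  simp only [List.length_cons, height_cons_eq_length_iff]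
  rw [Finset.filter_mem_eq_inter, Finset.inter_eq_right.2 h.head_subset]

theorem heightWord_injOn (ω : List ι) :
    Set.InjOn (heightWord ω) {L | IsLayering ω.toFinset L} := by
  intro L hL L' hL' h
  have hmap : ω.map (height L) = ω.map (height L') := by
    rw [← hL.coe_heightWord, ← hL'.coe_heightWord, h]
  have hlen : L.length = L'.length := by
    rw [← hL.maxLetter_heightWord, ← hL'.maxLetter_heightWord, h]
  rw [← hL.layers_height, ← hL'.layers_height, hlen]
  refine layers_congr fun k _ _ i => and_congr_right fun hi => ?_
  rw [List.map_inj_left.1 hmap i (List.mem_toFinset.1 hi)]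

theorem exists_heightWord_eq {v : PackedWord} (hv : v ∈ strictImages ω) :
    ∃ L, IsLayering ω.toFinset L ∧ heightWord ω L = v := by
  obtain ⟨f, hf, hfv⟩ := mem_strictImages.1 hv
  have hmem (k : ℕ) : (∃ i ∈ ω, f i = k) ↔ 1 ≤ k ∧ k ≤ maxLetter v.1 := by
    rw [← v.2.mem_iff, ← hfv, List.mem_map]
  have hle : ∀ i ∈ ω.toFinset, f i ≤ maxLetter v.1 := fun i hi =>
    ((hmem _).1 ⟨i, List.mem_toFinset.1 hi, rfl⟩).2
  refine ⟨layers ω.toFinset f (maxLetter v.1), ?_, ?_⟩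
  · convert isLayering_layers (T := ω.toFinset) (f := f) (by simpa using hf) (fun i hi => ?_)
      fun k hk hkv => ?_
    · exact (Finset.filter_true_of_mem hle).symm
    · exact ((hmem _).1 ⟨i, List.mem_toFinset.1 hi, rfl⟩).1
    · simpa using (hmem k).2 ⟨hk, hkv⟩
  · have hmap : ω.map (height (layers ω.toFinset f (maxLetter v.1))) = v := by
      rw [← hfv]
      refine List.map_congr_left fun i hi => ?_
      rw [hfv]
      exact height_layers (List.mem_toFinset.2 hi) (hle i (List.mem_toFinset.2 hi))
    rw [heightWord, hmap, pack_coe]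

theorem sum_strictImages {R : Type*} [AddCommMonoid R] (ω : List ι) (Φ : PackedWord → R) :
    ∑ v ∈ strictImages ω, Φ v = ∑ L ∈ layerings ω.toFinset, Φ (heightWord ω L) := by
  symm
  refine Finset.sum_nbij (heightWord ω) (fun L hL => ?_) (fun L hL L' hL' => ?_) (fun v hv => ?_)
    fun _ _ => rfl
  · rw [mem_layerings] at hL
    exact mem_strictImages.2 ⟨height L, by simpa using hL.strictMonoOn_height,
      hL.coe_heightWord.symm⟩
  · exact heightWord_injOn ω (mem_layerings.1 hL) (mem_layerings.1 hL')
  · obtain ⟨L, hL, rfl⟩ := exists_heightWord_eq hv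
    exact ⟨L, mem_layerings.2 hL, rfl⟩

end StrictImages

/-! ### The coefficients of `σ₁((1-t)A)` -/

section SigmaOneSub

theorem sum_ev (v : PackedWord) : (ev v).sum = v.1.length := by
  rw [← List.sum_toFinset_count_eq_length, v.2.sum_toFinset]
  rfl

theorem exists_map_val_eq_ev (v : PackedWord) : ∃ I : List ℕ+, I.map PNat.val = ev v := by
  refine CanLift.prf (β := List ℕ+) (ev v) fun a ha => ?_
  obtain ⟨k, hk, rfl⟩ := List.mem_map.1 ha
  exact List.count_pos_iff.2 (v.2.mem_iff.2 ⟨k.succ_pos, List.mem_range.1 hk⟩)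

variable {R : Type*} [CommRing R]

theorem symEmbed_apply (x : NSym R) {v : PackedWord} {I : List ℕ+} (hI : I.map PNat.val = ev v) :
    symEmbed R x v = x.coeff (FreeMonoid.ofList I) := by
  classical
  have hterm (J : FreeMonoid ℕ+) (c : R) :
      (c • ∑ u ∈ (PW ((J.toList.map PNat.val).sum)).filter
        (fun u => ev u = J.toList.map PNat.val), N R u) v =
      if J = FreeMonoid.ofList I then c else 0 := by
    rw [Finsupp.smul_apply, Finsupp.finsetSum_apply]
    simp only [N, Finsupp.single_apply, Finset.sum_ite_eq', Finset.mem_filter, mem_PW, smul_eq_mul,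
      mul_ite, mul_one, mul_zero]
    refine if_congr ⟨fun h => ?_, ?_⟩ rfl rfl
    · exact (List.map_injective_iff.2 PNat.coe_injective (hI.trans h.2)).symm
    · rintro rfl
      exact ⟨(sum_ev v).symm.trans (congrArg List.sum hI.symm), hI.symm⟩
  rw [symEmbed, Finsupp.sum, Finsupp.finsetSum_apply]
  simp only [hterm]
  simpa using fun h => h.symm

theorem completeS_coe (a : ℕ+) :
    completeS R a = MonoidAlgebra.of R (FreeMonoid ℕ+) (FreeMonoid.of a) := dif_pos a.2

theorem prod_map_completeS (l : List ℕ+) : ((l.map PNat.val).map (completeS R)).prod =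
    MonoidAlgebra.of R (FreeMonoid ℕ+) (FreeMonoid.ofList l) := by
  induction l with
  | nil => exact (map_one _).symm
  | cons a l ih =>
    rw [List.map_cons, List.map_cons, List.prod_cons, ih, FreeMonoid.ofList_cons, map_mul]
    exact congrArg (· * _) (completeS_coe a)

theorem coeff_prod_map_completeS_blocks {k : ℕ} (J : Composition k) (I : List ℕ+) :
    ((J.blocks.map (completeS R)).prod).coeff (FreeMonoid.ofList I) =
      if J.blocks = I.map PNat.val then 1 else 0 := by
  classical
  obtain ⟨l, hl⟩ := CanLift.prf (β := List ℕ+) J.blocks fun _ ha => J.blocks_pos ha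
  rw [← hl, prod_map_completeS, MonoidAlgebra.of_apply, MonoidAlgebra.coeff_single,
    Finsupp.single_apply]
  refine if_congr ?_ rfl rfl
  rw [(List.map_injective_iff.2 PNat.coe_injective).eq_iff, Equiv.apply_eq_iff_eq]

theorem coeff_neg_pow_smul_elementaryL (t : R) (k : ℕ) (I : List ℕ+) :
    ((-t) ^ k • elementaryL R k).coeff (FreeMonoid.ofList I) =
      if (I.map PNat.val).sum = k then (-1) ^ I.length * t ^ k else 0 := by
  rw [elementaryL, MonoidAlgebra.coeff_smul_apply, MonoidAlgebra.coeff_sum, Finsupp.finsetSum_apply]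
  simp only [MonoidAlgebra.coeff_smul_apply, coeff_prod_map_completeS_blocks]
  split_ifs with hI
  · have hpos : ∀ {a : ℕ}, a ∈ I.map PNat.val → 0 < a := fun ha => by
      obtain ⟨a, -, rfl⟩ := List.mem_map.1 ha
      exact a.2
    rw [Finset.sum_eq_single_of_mem ⟨I.map PNat.val, hpos, hI⟩ (Finset.mem_univ _) fun J _ hJ => by
      rw [if_neg fun h => hJ (Composition.ext h), smul_zero]]
    have hlen := (⟨I.map PNat.val, hpos, hI⟩ : Composition k).length_le
    simp only [Composition.length, List.length_map] at hlen ⊢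
    obtain ⟨m, rfl⟩ := Nat.exists_eq_add_of_le hlen
    have hsq : (-1 : R) ^ m * (-1) ^ m = 1 := by rw [← mul_pow]; simp
    rw [Nat.add_sub_cancel_left, neg_pow, pow_add (-1 : R), if_pos trivial, smul_eq_mul,
      smul_eq_mul]
    linear_combination (-1) ^ I.length * t ^ (I.length + m) * hsq
  · have hne (J : Composition k) : J.blocks ≠ I.map PNat.val := fun h => hI (h ▸ J.blocks_sum)
    simp [hne]

theorem coeff_mul_completeS (x : NSym R) (J : List ℕ+) (j c : ℕ+) :
    (x * completeS R c).coeff (FreeMonoid.ofList (J ++ [j])) =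
      if c = j then x.coeff (FreeMonoid.ofList J) else 0 := by
  rw [completeS_coe, MonoidAlgebra.of_apply]
  split_ifs with h
  · rw [h, MonoidAlgebra.coeff_mul_single_eq_coeff_mul (FreeMonoid.ofList J), mul_one]
    intro m _
    rw [FreeMonoid.ofList_append]
    exact mul_left_inj _
  · rw [MonoidAlgebra.coeff_mul_single_of_forall_mul_ne]
    intro d hd
    exact h (List.singleton_inj.1 (List.append_inj' (congrArg FreeMonoid.toList hd) rfl).2)

theorem coeff_sigmaOneSub (t : R) (I : List ℕ+) :
    (sigmaOneSub t (I.map PNat.val).sum).coeff (FreeMonoid.ofList I) =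
      sigmaCoeff t (I.map PNat.val).reverse := by
  have hzero : completeS R 0 = 1 := by simp [completeS]
  rcases List.eq_nil_or_concat I with rfl | ⟨J, j, rfl⟩
  · have hone := coeff_neg_pow_smul_elementaryL t 0 []
    simpa [sigmaOneSub, hzero, sigmaCoeff] using hone
  set k₀ := (J.map PNat.val).sum with hk₀
  have hn : ((J ++ [j]).map PNat.val).sum = k₀ + j := by simp [hk₀]
  have hterm : ∀ k ∈ Finset.range (k₀ + j),
      ((-t) ^ k • (elementaryL R k * completeS R (k₀ + j - k))).coeff
        (FreeMonoid.ofList (J ++ [j])) = if k = k₀ then (-1) ^ J.length * t ^ k₀ else 0 := by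
    intro k hk
    rw [Finset.mem_range] at hk
    obtain ⟨c, hc⟩ : ∃ c : ℕ+, (c : ℕ) = k₀ + j - k := ⟨⟨_, Nat.sub_pos_of_lt hk⟩, rfl⟩
    have hiff : c = j ↔ k = k₀ := by
      rw [← PNat.coe_inj, hc]
      omega
    rw [← hc, ← smul_mul_assoc, coeff_mul_completeS, coeff_neg_pow_smul_elementaryL, ← hk₀]
    grind
  rw [List.concat_eq_append, hn, sigmaOneSub, MonoidAlgebra.coeff_sum, Finsupp.finsetSum_apply,
    Finset.sum_range_succ, Finset.sum_congr rfl hterm, Finset.sum_ite_eq', Nat.sub_self, hzero,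
    mul_one, coeff_neg_pow_smul_elementaryL, if_pos hn, if_pos (by simp)]
  simp only [List.map_append, List.map_singleton, List.reverse_append, List.reverse_singleton,
    List.singleton_append, sigmaCoeff, List.length_reverse, List.length_map, List.sum_reverse,
    ← hk₀, List.length_append, List.length_singleton]
  ring

theorem symEmbed_sigmaOneSub (t : R) {n : ℕ} {v : PackedWord} (hv : v ∈ PW n) :
    symEmbed R (sigmaOneSub t n) v = sigmaCoeff t (ev v).reverse := by
  obtain ⟨I, hI⟩ := exists_map_val_eq_ev v
  rw [symEmbed_apply _ hI, ← hI, ← coeff_sigmaOneSub, hI, sum_ev, mem_PW.1 hv]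

end SigmaOneSub

/-! ### The value of `M_w` at `𝕏` -/

section Biwords

theorem packPair_pack {A : Type*} [LinearOrder A] (z : List A) (v : PackedWord) :
    packPair (pack z) v = pack (List.zipWith (fun a b => toLex (a, b)) z v.1) := by
  set φ : A ×ₗ ℕ → ℕ ×ₗ ℕ := fun p => toLex (rank z (ofLex p).1, (ofLex p).2)
  have hmap : List.zipWith (fun a b => toLex (a, b)) (packList z) v.1 =
      (List.zipWith (fun a b => toLex (a, b)) z v.1).map φ := by
    rw [packList, List.zipWith_map_left, List.map_zipWith]
    rfl
  refine Subtype.ext ((congrArg packList hmap).trans (packList_map φ _ fun p hp p' hp' h => ?_))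
  have hmem : ∀ p ∈ List.zipWith (fun a b => toLex (a, b)) z v.1, (ofLex p).1 ∈ z := by
    intro p hp
    rw [← List.map_uncurry_zip_eq_zipWith] at hp
    obtain ⟨x, hx, rfl⟩ := List.mem_map.1 hp
    exact (List.of_mem_zip hx).1
  have hrank := rank_strictMonoOn z
  rw [Prod.Lex.lt_iff] at h ⊢
  exact h.imp (fun h => hrank (hmem p hp) (hmem p' hp') h) (And.imp_left (congrArg (rank z)))

theorem packPair_pack_eq_iff {A : Type*} [LinearOrder A] [Nonempty A] {z : List A}
    {v w : PackedWord} (hlen : z.length = v.1.length) :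
    packPair (pack z) v = w ↔ ∃ (k : ℕ → A) (f : ℕ → ℕ), w.1.map k = z ∧ w.1.map f = v.1 ∧
      StrictMonoOn (fun i => toLex (k i, f i)) {i | i ∈ w.1} := by
  rw [packPair_pack]
  constructor
  · rintro rfl
    obtain ⟨φ, hφ, hφz⟩ := exists_strictMonoOn_map_packList_eq
      (List.zipWith (fun a b => toLex (a, b)) z v.1)
    refine ⟨fun i => (ofLex (φ i)).1, fun i => (ofLex (φ i)).2, ?_, ?_, hφ⟩
    · have hfst := congrArg (List.map fun p => (ofLex p).1) hφz
      rw [List.map_map, List.map_zipWith] at hfst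
      exact (hfst.trans List.map_zipWith.symm).trans (List.map_fst_zip hlen.le)
    · have hsnd := congrArg (List.map fun p => (ofLex p).2) hφz
      rw [List.map_map, List.map_zipWith] at hsnd
      exact (hsnd.trans List.map_zipWith.symm).trans (List.map_snd_zip hlen.ge)
  · rintro ⟨k, f, rfl, hf, hkf⟩
    rw [← hf, List.zipWith_map, List.zipWith_self]
    exact Subtype.ext (packList_map_of_isPacked w.2 hkf)

theorem exists_antitoneOn_of_packPair_eq {x : List ℕ} {v w : PackedWord}
    (hlen : x.length = v.1.length) (h : packPair (pack (x.map OrderDual.toDual)) v = w) :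
    ∃ g : ℕ → ℕ, AntitoneOn g {a | a ∈ w.1} ∧ w.1.map g = x := by
  obtain ⟨k, f, hk, -, hkf⟩ := (packPair_pack_eq_iff (by simpa using hlen)).1 h
  refine ⟨fun a => OrderDual.ofDual (k a), fun a ha b hb hab => ?_, ?_⟩
  · exact Prod.Lex.monotone_fst_ofLex (hkf.monotoneOn ha hb hab)
  · refine Eq.trans ?_ ((congrArg (List.map OrderDual.ofDual) hk).trans ?_) <;>
      simp [Function.comp_def]

theorem sigma_mk_lt_mk_iff {i j a b : ℕ} :
    (⟨i, a⟩ : Σ _ : ℕ, ℕ) < ⟨j, b⟩ ↔ i = j ∧ a < b := by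
  constructor
  · rintro ⟨_, _, _, h⟩
    exact ⟨rfl, h⟩
  · rintro ⟨rfl, h⟩
    exact Sigma.mk_lt_mk_iff.2 h

theorem packPair_map_eq_iff {g : ℕ → ℕ} {v w : PackedWord} (hg : AntitoneOn g {a | a ∈ w.1})
    (hlen : w.1.length = v.1.length) :
    packPair (pack ((w.1.map g).map OrderDual.toDual)) v = w ↔
      v ∈ strictImages (w.1.map fun a => (⟨g a, a⟩ : Σ _ : ℕ, ℕ)) := by
  rw [packPair_pack_eq_iff (by simpa using hlen), mem_strictImages]
  constructor
  · rintro ⟨k, f, hk, hf, hkf⟩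
    refine ⟨fun i => f i.2, ?_, by rw [List.map_map]; exact hf⟩
    intro i hi j hj hij
    obtain ⟨a, ha, rfl⟩ := List.mem_map.1 hi
    obtain ⟨b, hb, rfl⟩ := List.mem_map.1 hj
    obtain ⟨hgab, hab⟩ := sigma_mk_lt_mk_iff.1 hij
    rw [List.map_map, List.map_inj_left] at hk
    refine (Prod.Lex.toLex_lt_toLex.1 (hkf ha hb hab)).elim (fun h => absurd h ?_) And.right
    rw [hk a ha, hk b hb]
    exact (congrArg OrderDual.toDual hgab).not_lt
  · rintro ⟨f, hf, hfv⟩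
    rw [List.map_map] at hfv
    refine ⟨OrderDual.toDual ∘ g, _, List.map_map.symm, hfv, fun a ha b hb hab => ?_⟩
    rw [Prod.Lex.toLex_lt_toLex]
    refine (hg ha hb hab.le).lt_or_eq.imp (fun h => h) fun h =>
      ⟨congrArg OrderDual.toDual h.symm, ?_⟩
    exact hf (List.mem_map.2 ⟨a, ha, rfl⟩) (List.mem_map.2 ⟨b, hb, rfl⟩)
      (sigma_mk_lt_mk_iff.2 ⟨h.symm, hab⟩)

theorem filter_packPair_map {n : ℕ} {g : ℕ → ℕ} {w : PackedWord} (hw : w ∈ PW n)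
    (hg : AntitoneOn g {a | a ∈ w.1}) :
    {v ∈ PW n | packPair (pack ((w.1.map g).map OrderDual.toDual)) v = w} =
      strictImages (w.1.map fun a => (⟨g a, a⟩ : Σ _ : ℕ, ℕ)) := by
  ext v
  have hlen (h : v ∈ strictImages (w.1.map fun a => (⟨g a, a⟩ : Σ _ : ℕ, ℕ))) :
      w.1.length = v.1.length := by
    obtain ⟨f, -, hf⟩ := mem_strictImages.1 h
    simp [← hf]
  rw [Finset.mem_filter, mem_PW, ← mem_PW.1 hw]
  exact ⟨fun h => (packPair_map_eq_iff hg h.1.symm).1 h.2,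
    fun h => ⟨(hlen h).symm, (packPair_map_eq_iff hg (hlen h)).2 h⟩⟩

end Biwords

section Principal

variable {R : Type*} [CommRing R]

theorem eta_N_apply (t : R) {n : ℕ} {u : PackedWord} (hu : u ∈ PW n) (w : PackedWord) :
    eta t (N R u) w = ∑ v ∈ PW n with packPair u v = w, symEmbed R (sigmaOneSub t n) v := by
  rw [mem_PW] at hu
  set g := symEmbed R (sigmaOneSub t n)
  have hterm (v : PackedWord) :
      (if n = v.1.length then ((1 : R) * g v) • N R (packPair u v) else 0) w =
        if v ∈ {v ∈ PW n | packPair u v = w} then g v else 0 := by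
    simp only [Finset.mem_filter, mem_PW, eq_comm (a := n)]
    split_ifs <;> simp_all [N]
  rw [eta, N, Finsupp.linearCombination_single, one_smul, hu, internalMul, N,
    Finsupp.sum_single_index (by simp), Finsupp.sum, Finsupp.finsetSum_apply, hu,
    Finset.sum_congr rfl fun v _ => hterm v, Finset.sum_ite_mem]
  refine Finset.sum_subset Finset.inter_subset_right fun v hv hv' => ?_
  exact Finsupp.notMem_support_iff.1 fun h => hv' (Finset.mem_inter.2 ⟨h, hv⟩)

theorem finite_setOf_length_eq_and_sum_eq (n d : ℕ) :
    {x : List ℕ | x.length = n ∧ x.sum = d}.Finite := by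
  refine ((List.finite_length_eq (Fin (d + 1)) n).image (List.map Fin.val)).subset ?_
  rintro x ⟨hn, hd⟩
  have hlt : ∀ a ∈ x, a < d + 1 := fun a ha => Nat.lt_succ_of_le (hd ▸ List.le_sum_of_mem ha)
  exact ⟨x.pmap Fin.mk hlt, by simpa using hn, by simp [List.map_pmap]⟩

/-- The words of length `n` with sum of letters `d`, which are the words of length `n` over the
alphabet `1/(1-q)` that contribute to the coefficient of `q^d`. -/
noncomputable def wordsOfSum (n d : ℕ) : Finset (List ℕ) :=
  (finite_setOf_length_eq_and_sum_eq n d).toFinset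

theorem mem_wordsOfSum {n d : ℕ} {x : List ℕ} :
    x ∈ wordsOfSum n d ↔ x.length = n ∧ x.sum = d := by
  simp [wordsOfSum]

theorem coeff_principalM {n : ℕ} {u : PackedWord} (hu : u ∈ PW n) (d : ℕ) :
    PowerSeries.coeff d (principalM u : R⟦X⟧) =
      ({x ∈ wordsOfSum n d | pack (x.map OrderDual.toDual) = u}.card : R) := by
  rw [principalM, PowerSeries.coeff_mk]
  refine congrArg Nat.cast (Nat.subtype_card _ fun x => ?_)
  rw [Finset.mem_filter, mem_wordsOfSum]
  refine ⟨fun h => ⟨h.2, h.1.2⟩, fun h => ⟨⟨?_, h.2⟩, h.1⟩⟩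
  rw [← mem_PW.1 hu, ← h.1]
  simp [pack]

theorem coeff_principal_etaStar (t : R) {n : ℕ} {w : PackedWord} (hw : w ∈ PW n) (d : ℕ) :
    PowerSeries.coeff d (principal (etaStar t (M R w))) =
      ∑ x ∈ wordsOfSum n d, ∑ v ∈ PW n with packPair (pack (x.map OrderDual.toDual)) v = w,
        symEmbed R (sigmaOneSub t n) v := by
  have hmem : ∀ x ∈ wordsOfSum n d, pack (x.map OrderDual.toDual) ∈ PW n := fun x hx => by
    simp [pack, (mem_wordsOfSum.1 hx).1]
  rw [← basisM_apply, etaStar, Module.Basis.constr_basis, map_sum, map_sum, mem_PW.1 hw,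
    ← Finset.sum_fiberwise_of_maps_to hmem]
  refine Finset.sum_congr rfl fun u hu => ?_
  rw [map_smul, ← basisM_apply, principal, Module.Basis.constr_basis, PowerSeries.coeff_smul,
    coeff_principalM hu, eta_N_apply t hu, smul_eq_mul, mul_comm, ← nsmul_eq_mul,
    ← Finset.sum_const]
  exact Finset.sum_congr rfl fun x hx => by rw [(Finset.mem_filter.1 hx).2]

open scoped Classical in
theorem sum_symEmbed_sigmaOneSub (t : R) {n : ℕ} {w : PackedWord} (hw : w ∈ PW n) (hn : 0 < n)
    {g : ℕ → ℕ} (hg : AntitoneOn g {a | a ∈ w.1}) :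
    ∑ v ∈ PW n with packPair (pack ((w.1.map g).map OrderDual.toDual)) v = w,
        symEmbed R (sigmaOneSub t n) v =
      ∏ a ∈ w.1.toFinset, if ∃ b ∈ w.1, a < b ∧ g a = g b then -t ^ w.1.count a
        else 1 - t ^ w.1.count a := by
  set e : ℕ → Σ _ : ℕ, ℕ := fun a => ⟨g a, a⟩ with he
  have he_inj : Function.Injective e := fun a b h => congrArg Sigma.snd h
  set T := (w.1.map e).toFinset with hT
  have hTimage : T = w.1.toFinset.image e := by ext; simp [hT]
  have hTne : T.Nonempty := by
    rw [hT, List.toFinset_nonempty_iff, Ne, List.map_eq_nil_iff, ← List.length_eq_zero_iff]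
    exact (mem_PW.1 hw).trans_ne hn.ne'
  have hlayer : ∀ L ∈ layerings T, symEmbed R (sigmaOneSub t n) (heightWord (w.1.map e) L) =
      sigmaCoeff t (blockSums (w.1.map e).count L) := by
    intro L hL
    rw [symEmbed_sigmaOneSub t, (mem_layerings.1 hL).reverse_ev_heightWord]
    simpa [heightWord, pack] using hw
  have hmax : ∀ a ∈ w.1, e a ∉ maximals T ↔ ∃ b ∈ w.1, a < b ∧ g a = g b := by
    intro a ha
    rw [mem_maximals, not_maximal_iff_exists_gt (by simpa [hT, he] using ha)]
    simp [hT, he, sigma_mk_lt_mk_iff, and_comm, and_left_comm, eq_comm]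
  calc
    _ = ∏ i ∈ T, if i ∈ maximals T then 1 - t ^ (w.1.map e).count i
          else -t ^ (w.1.map e).count i := by
      rw [filter_packPair_map hw hg, sum_strictImages, Finset.sum_congr rfl hlayer,
        sum_layerings_sigmaCoeff _ _ hTne, Finset.prod_ite, Finset.filter_mem_eq_inter,
        Finset.inter_eq_right.2 (maximals_subset T), Finset.filter_notMem_eq_sdiff]
    _ = _ := by
      rw [Finset.prod_congr hTimage fun _ _ => rfl, Finset.prod_image he_inj.injOn]
      refine Finset.prod_congr rfl fun a ha => ?_
      rw [List.count_map_of_injective _ _ he_inj, ← ite_not]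
      exact if_congr (hmax a (List.mem_toFinset.1 ha)) rfl rfl

end Principal

section Descents

variable {w : List ℕ}

/-- The image of the packed word `w` by the antitone map `a ↦ e (a - 1) + ⋯ + e (p - 1)`, where `p`
is the maximal letter of `w`: the value of this map drops by `e i` from the letter `i + 1` to the
letter `i + 2`. -/
def descentWord (w : List ℕ) (e : ℕ → ℕ) : List ℕ :=
  w.map fun a => ∑ i ∈ Finset.Ico (a - 1) (maxLetter w), e i

/-- The number of letters of `w` among `1, …, i + 1`. -/
def prefixCount (w : List ℕ) (i : ℕ) : ℕ := ∑ j ∈ Finset.range (i + 1), w.count (j + 1)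

theorem prefixCount_ne_zero (hw : IsPacked w) (hne : w ≠ []) (i : ℕ) : prefixCount w i ≠ 0 := by
  have h₁ : 1 ∈ w := hw.mem_iff.2 ⟨le_rfl, (hw.mem_iff.1 (maxLetter_mem hne)).1⟩
  refine (Finset.sum_pos' (fun _ _ => Nat.zero_le _) ⟨0, by simp, ?_⟩).ne'
  exact List.count_pos_iff.2 h₁

theorem sum_descentWord (hw : IsPacked w) (e : ℕ → ℕ) :
    (descentWord w e).sum = ∑ i ∈ Finset.range (maxLetter w), prefixCount w i * e i := by
  rw [descentWord, Finset.sum_list_map_count, hw.sum_toFinset]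
  simp only [Nat.add_sub_cancel, smul_eq_mul, prefixCount, Finset.mul_sum, Finset.sum_mul]
  exact Finset.sum_comm' fun k i => by simp only [Finset.mem_range, Finset.mem_Ico]; omega

theorem descentWord_congr {e e' : ℕ → ℕ} (h : ∀ i < maxLetter w, e i = e' i) :
    descentWord w e = descentWord w e' :=
  List.map_congr_left fun _ _ => Finset.sum_congr rfl fun _ hi => h _ (Finset.mem_Ico.1 hi).2

theorem sum_Ico_eq_of_descentWord_eq (hw : IsPacked w) {e e' : ℕ → ℕ}
    (h : descentWord w e = descentWord w e') {i : ℕ} (hi : i ≤ maxLetter w) :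
    ∑ j ∈ Finset.Ico i (maxLetter w), e j = ∑ j ∈ Finset.Ico i (maxLetter w), e' j := by
  rcases hi.eq_or_lt with rfl | hi
  · simp
  · exact List.map_inj_left.1 h (i + 1) (hw.mem_iff.2 ⟨by omega, hi⟩)

theorem eqOn_of_descentWord_eq (hw : IsPacked w) {e e' : ℕ → ℕ}
    (h : descentWord w e = descentWord w e') {i : ℕ} (hi : i < maxLetter w) : e i = e' i := by
  have hs := sum_Ico_eq_of_descentWord_eq hw h hi.le
  have hs' := sum_Ico_eq_of_descentWord_eq hw h (i := i + 1) hi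
  rw [Finset.sum_eq_sum_Ico_succ_bot hi, Finset.sum_eq_sum_Ico_succ_bot hi, hs'] at hs
  exact Nat.add_right_cancel hs

theorem sum_Ico_sub_succ_of_antitone {f : ℕ → ℕ} (hf : Antitone f) {a b : ℕ} (hab : a ≤ b) :
    ∑ i ∈ Finset.Ico a b, (f i - f (i + 1)) = f a - f b := by
  induction b, hab using Nat.le_induction with
  | base => simp
  | succ b hab ih =>
    rw [Finset.sum_Ico_succ_top hab, ih]
    exact tsub_add_tsub_cancel (hf hab) (hf b.le_succ)

theorem exists_descentWord_eq_map (hw : IsPacked w) {g : ℕ → ℕ} (hg : AntitoneOn g {a | a ∈ w}) :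
    ∃ e : ℕ → ℕ, descentWord w e = w.map g := by
  set f : ℕ → ℕ := fun i => if i < maxLetter w then g (i + 1) else 0 with hf
  have hfanti : Antitone f := by
    intro i j hij
    simp only [hf]
    split_ifs with hj hi
    · exact hg (hw.mem_iff.2 ⟨by omega, hi⟩) (hw.mem_iff.2 ⟨by omega, hj⟩) (by omega)
    · omega
    all_goals exact Nat.zero_le _
  refine ⟨fun i => f i - f (i + 1), List.map_congr_left fun a ha => ?_⟩
  obtain ⟨ha₁, hap⟩ := hw.mem_iff.1 ha
  rw [sum_Ico_sub_succ_of_antitone hfanti (by omega)]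
  simp only [hf, lt_irrefl, if_false, Nat.sub_zero, Nat.sub_add_cancel ha₁]
  exact if_pos (by omega)

theorem antitone_sum_Ico (e : ℕ → ℕ) (p : ℕ) :
    Antitone fun a => ∑ i ∈ Finset.Ico (a - 1) p, e i := fun _ _ hab =>
  Finset.sum_le_sum_of_subset (Finset.Ico_subset_Ico_left (Nat.sub_le_sub_right hab 1))

theorem exists_sum_Ico_eq_iff (hw : IsPacked w) (e : ℕ → ℕ) {i : ℕ} (hi : i < maxLetter w) :
    (∃ b ∈ w, i + 1 < b ∧ ∑ j ∈ Finset.Ico i (maxLetter w), e j =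
      ∑ j ∈ Finset.Ico (b - 1) (maxLetter w), e j) ↔ i + 1 < maxLetter w ∧ e i = 0 := by
  constructor
  · rintro ⟨b, hb, hib, h⟩
    have hbp := (hw.mem_iff.1 hb).2
    have hle : ∑ j ∈ Finset.Ico (b - 1) (maxLetter w), e j ≤
        ∑ j ∈ Finset.Ico (i + 1) (maxLetter w), e j :=
      antitone_sum_Ico e _ (by omega : i + 1 + 1 ≤ b)
    rw [Finset.sum_eq_sum_Ico_succ_bot hi] at h
    omega
  · rintro ⟨hip, he⟩
    refine ⟨i + 2, hw.mem_iff.2 ⟨by omega, hip⟩, by omega, ?_⟩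
    rw [Finset.sum_eq_sum_Ico_succ_bot hi, he, zero_add]
    rfl

end Descents

section Series

variable {R : Type*} [CommRing R]

theorem coeff_prod_expand {ι : Type*} [DecidableEq ι] (s : Finset ι) {Q : ι → ℕ}
    (hQ : ∀ i, Q i ≠ 0) (φ : ι → R⟦X⟧) (d : ℕ) :
    PowerSeries.coeff d (∏ i ∈ s, PowerSeries.expand (Q i) (hQ i) (φ i)) =
      ∑ l ∈ s.finsuppAntidiag d with ∀ i ∈ s, Q i ∣ l i,
        ∏ i ∈ s, PowerSeries.coeff (l i / Q i) (φ i) := by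
  simp only [PowerSeries.coeff_prod, PowerSeries.coeff_expand, Finset.prod_ite_zero,
    Finset.sum_filter]

theorem sum_wordsOfSum {w : List ℕ} (hw : IsPacked w) (hQ : ∀ i, prefixCount w i ≠ 0) (d : ℕ)
    {Φ : List ℕ → R} (hΦ : ∀ x ∈ wordsOfSum w.length d, Φ x ≠ 0 →
      ∃ g : ℕ → ℕ, AntitoneOn g {a | a ∈ w} ∧ w.map g = x) :
    ∑ x ∈ wordsOfSum w.length d, Φ x =
      ∑ l ∈ (Finset.range (maxLetter w)).finsuppAntidiag d with
          ∀ i ∈ Finset.range (maxLetter w), prefixCount w i ∣ l i,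
        Φ (descentWord w fun i => l i / prefixCount w i) := by
  set P := Finset.range (maxLetter w)
  set Q := prefixCount w
  symm
  refine Finset.sum_of_injOn (fun l => descentWord w fun i => l i / Q i) ?_ ?_ ?_ fun _ _ => rfl
  · intro l hl l' hl' h
    simp only [Finset.coe_filter, Finset.mem_finsuppAntidiag, Set.mem_ofPred_eq] at hl hl'
    ext i
    by_cases hi : i ∈ P
    · exact (Nat.div_left_inj (hl.2 i hi) (hl'.2 i hi)).1
        (eqOn_of_descentWord_eq hw h (Finset.mem_range.1 hi))
    · rw [Finsupp.notMem_support_iff.1 fun h => hi (hl.1.2 h),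
        Finsupp.notMem_support_iff.1 fun h => hi (hl'.1.2 h)]
  · intro l hl
    simp only [Finset.coe_filter, Finset.mem_finsuppAntidiag, Set.mem_ofPred_eq] at hl
    refine mem_wordsOfSum.2 ⟨List.length_map _, ?_⟩
    rw [sum_descentWord hw, ← hl.1.1]
    exact Finset.sum_congr rfl fun i hi => Nat.mul_div_cancel' (hl.2 i hi)
  · intro x hx hxl
    by_contra hΦx
    obtain ⟨g, hg, rfl⟩ := hΦ x hx hΦx
    obtain ⟨e, he⟩ := exists_descentWord_eq_map hw hg
    refine hxl ⟨Finsupp.indicator P fun i _ => Q i * e i, ?_, ?_⟩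
    · simp only [Finset.coe_filter, Finset.mem_finsuppAntidiag, Set.mem_ofPred_eq]
      refine ⟨⟨?_, Finsupp.support_indicator_subset _ _⟩, fun i hi => ?_⟩
      · rw [← (mem_wordsOfSum.1 hx).2, ← he, sum_descentWord hw]
        exact Finset.sum_congr rfl fun i hi => Finsupp.indicator_of_mem hi _
      · rw [Finsupp.indicator_of_mem hi]
        exact dvd_mul_right _ _
    · rw [← he]
      refine descentWord_congr fun i hi => ?_
      rw [Finsupp.indicator_of_mem (Finset.mem_range.2 hi)]
      exact Nat.mul_div_cancel_left _ (hQ i).bot_lt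

theorem sum_symEmbed_descentWord (t : R) {w : PackedWord} (hne : w.1 ≠ []) (e : ℕ → ℕ) :
    ∑ v ∈ PW w.1.length with packPair (pack ((descentWord w.1 e).map OrderDual.toDual)) v = w,
        symEmbed R (sigmaOneSub t w.1.length) v =
      ∏ i ∈ Finset.range (maxLetter w.1), if i + 1 < maxLetter w.1 ∧ e i = 0
        then -t ^ w.1.count (i + 1) else 1 - t ^ w.1.count (i + 1) := by
  classical
  rw [descentWord, sum_symEmbed_sigmaOneSub t (mem_PW.2 rfl) (List.length_pos_iff.2 hne)
    ((antitone_sum_Ico e _).antitoneOn _), w.2.prod_toFinset]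
  exact Finset.prod_congr rfl fun i hi =>
    if_congr (exists_sum_Ico_eq_iff w.2 e (Finset.mem_range.1 hi)) rfl rfl

theorem principal_etaStar_M (t : R) {w : PackedWord} (hne : w.1 ≠ []) :
    principal (etaStar t (M R w)) = ∏ i ∈ Finset.range (maxLetter w.1),
      PowerSeries.expand (prefixCount w.1 i) (prefixCount_ne_zero w.2 hne i)
        (PowerSeries.mk fun k =>
          if i + 1 < maxLetter w.1 ∧ k = 0 then -t ^ w.1.count (i + 1)
          else 1 - t ^ w.1.count (i + 1)) := by
  have hQ := prefixCount_ne_zero w.2 hne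
  ext d
  rw [coeff_principal_etaStar t (mem_PW.2 rfl), coeff_prod_expand, sum_wordsOfSum w.2 hQ]
  · simp only [sum_symEmbed_descentWord t hne, PowerSeries.coeff_mk]
  · intro x hx hsum
    obtain ⟨v, hv, -⟩ := Finset.exists_ne_zero_of_sum_ne_zero hsum
    obtain ⟨hv, hxv⟩ := Finset.mem_filter.1 hv
    exact exists_antitoneOn_of_packPair_eq
      ((mem_wordsOfSum.1 hx).1.trans (mem_PW.1 hv).symm) hxv

variable {F : Type*} [Field F] {φ : R⟦X⟧ →+* F}

theorem map_expand_mk_one_mul (φ : R⟦X⟧ →+* F) {Q : ℕ} (hQ : Q ≠ 0) :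
    φ (PowerSeries.expand Q hQ (PowerSeries.mk 1)) * (1 - φ PowerSeries.X ^ Q) = 1 := by
  have h := congrArg (fun f => φ (PowerSeries.expand Q hQ f))
    (PowerSeries.mk_one_mul_one_sub_eq_one R)
  simpa only [map_mul, map_sub, map_one, PowerSeries.expand_X, map_pow] using h

theorem map_expand_mk_const {Q : ℕ} (hQ : Q ≠ 0) (hφ : 1 - φ PowerSeries.X ^ Q ≠ 0) (b : R) :
    φ (PowerSeries.expand Q hQ (PowerSeries.mk fun _ => 1 - b)) =
      (1 - φ (PowerSeries.C b)) / (1 - φ PowerSeries.X ^ Q) := by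
  have hb : (PowerSeries.mk fun _ => 1 - b) = PowerSeries.mk 1 * (1 - PowerSeries.C b) := by
    ext k
    simp [mul_sub]
  rw [eq_div_iff hφ, hb, map_mul, map_mul, mul_right_comm, map_expand_mk_one_mul, one_mul, map_sub,
    map_sub, map_one, map_one, PowerSeries.expand_C]

theorem map_expand_mk_ite {Q : ℕ} (hQ : Q ≠ 0) (hφ : 1 - φ PowerSeries.X ^ Q ≠ 0) (b : R) :
    φ (PowerSeries.expand Q hQ (PowerSeries.mk fun k => if k = 0 then -b else 1 - b)) =
      (φ PowerSeries.X ^ Q - φ (PowerSeries.C b)) / (1 - φ PowerSeries.X ^ Q) := by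
  have hb : (PowerSeries.mk fun k => if k = 0 then -b else 1 - b) =
      PowerSeries.mk 1 * (PowerSeries.X - PowerSeries.C b) := by
    ext k
    rcases k with - | k <;> simp [mul_sub, PowerSeries.coeff_succ_mul_X]
  rw [eq_div_iff hφ, hb, map_mul, map_mul, mul_right_comm, map_expand_mk_one_mul, one_mul, map_sub,
    map_sub, PowerSeries.expand_C, PowerSeries.expand_X, map_pow]

theorem chainProd_reverse_map_range (x y : F) (c : ℕ → ℕ) (p : ℕ) :
    chainProd x y ((List.range p).map c).reverse =
      ∏ i ∈ Finset.range p, hookFactor x y (∑ j ∈ Finset.range (i + 1), c j) (c i) := by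
  induction p with
  | zero => rfl
  | succ p ih =>
    rw [List.range_succ, List.map_append, List.map_singleton, List.reverse_concat, chainProd, ih,
      Finset.prod_range_succ, mul_comm, List.sum_reverse, Finset.sum_range_succ, add_comm (c p)]
    rfl

end Series

section Specialization

variable {K : Type*} [Field K]

theorem one_sub_q_pow_ne_zero {n : ℕ} (hn : 0 < n) : 1 - q K ^ n ≠ 0 := by
  intro h
  rw [q, ← map_pow, ← map_one (HahnSeries.ofPowerSeries ℤ (RatFunc K)), ← map_sub,
    map_eq_zero_iff _ HahnSeries.ofPowerSeries_injective] at h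
  simpa [hn.ne'] using congrArg (PowerSeries.coeff 0) h

theorem one_sub_t_pow_ne_zero {n : ℕ} (hn : 0 < n) : 1 - t K ^ n ≠ 0 := by
  intro h
  rw [t, ← map_pow, ← map_one HahnSeries.C, ← map_sub, map_eq_zero_iff _ HahnSeries.C_injective,
    sub_eq_zero, ← RatFunc.algebraMap_X, ← map_pow, ← map_one (algebraMap (Polynomial K) _),
    (RatFunc.algebraMap_injective K).eq_iff] at h
  simpa [hn.ne] using congrArg Polynomial.natDegree h

theorem atX_M {w : PackedWord} (hne : w.1 ≠ []) :
    atX (M (RatFunc K) w) = (1 - t K ^ Nmax w.1) / (1 - q K ^ w.1.length) *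
      chainProd (q K) (t K) (ev w).reverse.tail := by
  have hQ := prefixCount_ne_zero w.2 hne
  obtain ⟨p, hp⟩ : ∃ p, maxLetter w.1 = p + 1 :=
    Nat.exists_eq_succ_of_ne_zero (Nat.one_le_iff_ne_zero.1 (w.2.mem_iff.1 (maxLetter_mem hne)).1)
  set φ := HahnSeries.ofPowerSeries ℤ (RatFunc K)
  have hX (i : ℕ) : 1 - φ PowerSeries.X ^ prefixCount w.1 i ≠ 0 :=
    one_sub_q_pow_ne_zero (hQ i).bot_lt
  have hlen : prefixCount w.1 p = w.1.length := by
    rw [← sum_ev, ev, hp]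
    rfl
  have htail : (ev w).reverse.tail = ((List.range p).map fun k => w.1.count (k + 1)).reverse := by
    rw [ev, hp, List.range_succ, List.map_append, List.map_singleton, List.reverse_concat,
      List.tail_cons]
  have ht (k : ℕ) : φ (PowerSeries.C (RatFunc.X ^ k)) = t K ^ k := by
    rw [map_pow, map_pow]
    exact congrArg (· ^ k) (HahnSeries.ofPowerSeries_C _)
  rw [htail, chainProd_reverse_map_range, atX, principal_etaStar_M _ hne, hp]
  change φ _ = _
  rw [map_prod, Finset.prod_range_succ, mul_comm]
  congr 1
  · simp only [lt_irrefl, false_and, if_false]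
    rw [map_expand_mk_const _ (hX p), ht, hlen, Nmax, hp]
    rfl
  · refine Finset.prod_congr rfl fun i hi => ?_
    simp only [Nat.add_lt_add_iff_right, Finset.mem_range.1 hi, true_and]
    rw [map_expand_mk_ite _ (hX i), ht]
    rfl

end Specialization

/-! ### Hook products -/

section HookProducts

variable {K : Type*} [Field K] {ι : Type*}

/-- The hook factor of the letter `i` of the word `ω` over a poset: the size of its hook is the
number of letters of `ω` that are at most `i`. -/
noncomputable def letterFactor (K : Type*) [Field K] [Preorder ι] [DecidableEq ι] (ω : List ι)
    (i : ι) : (RatFunc K)⸨X⸩ :=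
  hookFactor (q K) (t K) (hook ω.count ω.toFinset i) (ω.count i)

section Layerings

variable [PartialOrder ι] [DecidableEq ι] {ω : List ι} {S : Finset ι}

theorem atX_M_heightWord_cons {L : List (Finset ι)} (h : IsLayering ω.toFinset (S :: L)) :
    atX (M (RatFunc K) (heightWord ω (S :: L))) =
      (1 - t K ^ ∑ i ∈ S, ω.count i) / (1 - q K ^ ω.length) *
        chainProd (q K) (t K) (blockSums ω.count L) := by
  have hlen : (heightWord ω (S :: L)).1.length = ω.length := by
    rw [h.coe_heightWord, List.length_map]
  have hne : (heightWord ω (S :: L)).1 ≠ [] := by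
    intro h0
    have hmax := h.maxLetter_heightWord
    rw [h0] at hmax
    exact absurd hmax (Nat.succ_ne_zero _).symm
  rw [atX_M hne, h.reverse_ev_heightWord, hlen, h.Nmax_heightWord]
  rfl

theorem sum_layerings_atX_M_heightWord_cons (hω : IsForest ω.toFinset) (hne : S.Nonempty)
    (hS : S ⊆ maximals ω.toFinset) :
    ∑ L ∈ layerings (ω.toFinset \ S), atX (M (RatFunc K) (heightWord ω (S :: L))) =
      (1 - t K ^ ∑ i ∈ S, ω.count i) / (1 - q K ^ ω.length) *
        ∏ i ∈ ω.toFinset \ S, letterFactor K ω i := by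
  have hcount : ∀ i ∈ ω.toFinset \ S, 0 < ω.count i := fun i hi =>
    List.count_pos_iff.2 (List.mem_toFinset.1 (Finset.sdiff_subset hi))
  rw [Finset.sum_congr rfl fun L hL =>
      atX_M_heightWord_cons (IsLayering.cons hne hS (mem_layerings.1 hL)),
    ← Finset.mul_sum, sum_layerings_chainProd (fun _ => one_sub_q_pow_ne_zero) _
      hcount (hω.mono Finset.sdiff_subset)]
  congr 1
  exact Finset.prod_congr rfl fun i hi => by rw [hook_sdiff _ hS hi, letterFactor]

end Layerings

theorem maximals_toFinset {w : List ℕ} (hne : w ≠ []) : maximals w.toFinset = {maxLetter w} := by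
  ext a
  rw [mem_maximals, Finset.mem_singleton]
  constructor
  · intro ha
    exact ha.eq_of_le (List.mem_toFinset.2 (maxLetter_mem hne))
      (le_maxLetter (List.mem_toFinset.1 ha.prop))
  · rintro rfl
    exact ⟨List.mem_toFinset.2 (maxLetter_mem hne), fun b hb _ =>
      le_maxLetter (List.mem_toFinset.1 hb)⟩

theorem strictImages_coe (u : PackedWord) : strictImages u.1 = {u} := by
  ext v
  rw [mem_strictImages, Finset.mem_singleton]
  constructor
  · rintro ⟨f, hf, hfv⟩
    apply Subtype.ext
    rw [← packList_map_of_isPacked u.2 hf, hfv, packList_of_isPacked v.2]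
  · rintro rfl
    exact ⟨id, strictMono_id.strictMonoOn _, List.map_id _⟩

/-- The product of the hook factors of the letters of `u` other than its maximal one. -/
noncomputable def innerProd (K : Type*) [Field K] (u : PackedWord) : (RatFunc K)⸨X⸩ :=
  ∏ a ∈ u.1.toFinset \ {maxLetter u.1}, letterFactor K u.1 a

theorem atX_M_eq_mul_innerProd {u : PackedWord} (hne : u.1 ≠ []) :
    atX (M (RatFunc K) u) =
      (1 - t K ^ Nmax u.1) / (1 - q K ^ u.1.length) * innerProd K u := by
  have hT : u.1.toFinset.Nonempty := (List.toFinset_nonempty_iff _).2 hne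
  have hmax := maximals_toFinset hne
  have hsets : ({maxLetter u.1} : Finset ℕ).powerset.erase ∅ = {{maxLetter u.1}} := by
    ext S
    have := Finset.singleton_ne_empty (maxLetter u.1)
    rw [Finset.mem_erase, Finset.mem_powerset, Finset.subset_singleton_iff, Finset.mem_singleton]
    grind
  rw [← Finset.sum_singleton (fun v => atX (M (RatFunc K) v)) u, ← strictImages_coe,
    sum_strictImages, sum_layerings hT, hmax, hsets, Finset.sum_singleton,
    sum_layerings_atX_M_heightWord_cons (isForest_of_linearOrder _)
      (Finset.singleton_nonempty _) hmax.ge, Finset.sum_singleton]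
  rfl

theorem letterFactor_maxLetter (w : List ℕ) :
    letterFactor K w (maxLetter w) = hookFactor (q K) (t K) w.length (Nmax w) := by
  have hall : ∀ a ∈ w.toFinset, a ≤ maxLetter w := fun a ha =>
    le_maxLetter (List.mem_toFinset.1 ha)
  rw [letterFactor, hook_of_forall_le _ hall, List.sum_toFinset_count_eq_length, Nmax]

theorem prod_letterFactor {u : PackedWord} (hne : u.1 ≠ []) :
    ∏ a ∈ u.1.toFinset, letterFactor K u.1 a =
      hookFactor (q K) (t K) u.1.length (Nmax u.1) * innerProd K u := by
  rw [← letterFactor_maxLetter, innerProd, mul_comm, Finset.sdiff_singleton_eq_erase,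
    Finset.prod_erase_mul _ _ (List.mem_toFinset.2 (maxLetter_mem hne))]

end HookProducts

/-! ### The partial products -/

section PartialProducts

section DisjointConcat

variable {ι κ : Type*}

/-- The concatenation of `x` and `y`, as a word over the disjoint union of their alphabets, in which
no letter of `x` is comparable to a letter of `y`. -/
def disjointConcat (x : List ι) (y : List κ) : List (ι ⊕ κ) := x.map Sum.inl ++ y.map Sum.inr

variable {x : List ι} {y : List κ}

theorem mem_strictImages_disjointConcat {u₁ u₂ v : PackedWord} :
    v ∈ strictImages (disjointConcat u₁.1 u₂.1) ↔
      pack (v.1.take u₁.1.length) = u₁ ∧ pack (v.1.drop u₁.1.length) = u₂ := by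
  rw [mem_strictImages]
  constructor
  · rintro ⟨f, hf, hfv⟩
    have hmono₁ : StrictMonoOn (f ∘ Sum.inl) {a | a ∈ u₁.1} := fun a ha b hb hab =>
      hf (by simpa [disjointConcat] using ha) (by simpa [disjointConcat] using hb)
        (Sum.inl_lt_inl_iff.2 hab)
    have hmono₂ : StrictMonoOn (f ∘ Sum.inr) {a | a ∈ u₂.1} := fun a ha b hb hab =>
      hf (by simpa [disjointConcat] using ha) (by simpa [disjointConcat] using hb)
        (Sum.inr_lt_inr_iff.2 hab)
    rw [disjointConcat, List.map_append, List.map_map, List.map_map] at hfv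
    constructor <;> apply Subtype.ext
    · rw [← hfv, List.take_left' (List.length_map _)]
      exact packList_map_of_isPacked u₁.2 hmono₁
    · rw [← hfv, List.drop_left' (List.length_map _)]
      exact packList_map_of_isPacked u₂.2 hmono₂
  · rintro ⟨h₁, h₂⟩
    obtain ⟨φ, hφ, hφv⟩ := exists_strictMonoOn_map_packList_eq (v.1.take u₁.1.length)
    obtain ⟨ψ, hψ, hψv⟩ := exists_strictMonoOn_map_packList_eq (v.1.drop u₁.1.length)
    have h₁' : packList (v.1.take u₁.1.length) = u₁ := congrArg Subtype.val h₁
    have h₂' : packList (v.1.drop u₁.1.length) = u₂ := congrArg Subtype.val h₂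
    rw [h₁'] at hφ hφv
    rw [h₂'] at hψ hψv
    refine ⟨Sum.elim φ ψ, ?_, ?_⟩
    · rintro (a | a) ha (b | b) hb hab
      · exact hφ (by simpa [disjointConcat] using ha) (by simpa [disjointConcat] using hb)
          (Sum.inl_lt_inl_iff.1 hab)
      · exact absurd hab Sum.not_inl_lt_inr
      · exact absurd hab Sum.not_inr_lt_inl
      · exact hψ (by simpa [disjointConcat] using ha) (by simpa [disjointConcat] using hb)
          (Sum.inr_lt_inr_iff.1 hab)
    · rw [disjointConcat, List.map_append, List.map_map, List.map_map, Sum.elim_comp_inl,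
        Sum.elim_comp_inr, hφv, hψv, List.take_append_drop]

theorem toFinset_disjointConcat [DecidableEq ι] [DecidableEq κ] (x : List ι) (y : List κ) :
    (disjointConcat x y).toFinset = x.toFinset.disjSum y.toFinset := by
  ext (i | i) <;> simp [disjointConcat]

theorem count_map_append_map_left [DecidableEq ι] {α : Type*} [DecidableEq α]
    {g : ι → α} {h : κ → α} (hg : g.Injective) (hgh : ∀ i j, g i ≠ h j) (x : List ι) (y : List κ)
    (i : ι) : (x.map g ++ y.map h).count (g i) = x.count i := by
  have hnot : g i ∉ y.map h := fun hi => by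
    obtain ⟨j, -, hj⟩ := List.mem_map.1 hi
    exact hgh i j hj.symm
  rw [List.count_append, List.count_eq_zero.2 hnot, List.count_map_of_injective _ _ hg, add_zero]

theorem count_map_append_map_right [DecidableEq κ] {α : Type*} [DecidableEq α]
    {g : ι → α} {h : κ → α} (hh : h.Injective) (hgh : ∀ i j, g i ≠ h j) (x : List ι) (y : List κ)
    (j : κ) : (x.map g ++ y.map h).count (h j) = y.count j := by
  rw [List.perm_append_comm.count_eq, count_map_append_map_left hh fun j i => (hgh i j).symm]

variable (K : Type*) [Field K] [Preorder ι] [DecidableEq ι] [Preorder κ] [DecidableEq κ]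

theorem letterFactor_disjointConcat_inl (x : List ι) (y : List κ) (i : ι) :
    letterFactor K (disjointConcat x y) (Sum.inl i) = letterFactor K x i := by
  have hcount := count_map_append_map_left (h := Sum.inr) Sum.inl_injective
    (fun _ _ => Sum.inl_ne_inr) x y
  rw [letterFactor, toFinset_disjointConcat, hook_disjSum_inl, letterFactor]
  exact congrArg₂ _ (congrArg (hook · _ _) (funext hcount)) (hcount i)

theorem letterFactor_disjointConcat_inr (x : List ι) (y : List κ) (i : κ) :
    letterFactor K (disjointConcat x y) (Sum.inr i) = letterFactor K y i := by
  have hcount := count_map_append_map_right (g := Sum.inl) Sum.inr_injective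
    (fun _ _ => Sum.inl_ne_inr) x y
  rw [letterFactor, toFinset_disjointConcat, hook_disjSum_inr, letterFactor]
  exact congrArg₂ _ (congrArg (hook · _ _) (funext hcount)) (hcount i)

end DisjointConcat

theorem partialMul_wordM (R : Type*) [CommRing R] (r : ℕ → ℕ → Prop) [DecidableRel r]
    {u₁ u₂ : PackedWord} (h₁ : u₁.1 ≠ []) (h₂ : u₂.1 ≠ []) (w : List ℕ) :
    partialMul r (wordM R u₁) (wordM R u₂) w =
      if (pack (w.take u₁.1.length) = u₁ ∧ pack (w.drop u₁.1.length) = u₂) ∧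
        r (maxLetter (w.take u₁.1.length)) (maxLetter (w.drop u₁.1.length)) then 1 else 0 := by
  have hlen {x : List ℕ} {u : PackedWord} (h : pack x = u) : x.length = u.1.length := by
    rw [← h, pack, length_packList]
  have hpos₁ := List.length_pos_iff.2 h₁
  have hpos₂ := List.length_pos_iff.2 h₂
  rw [partialMul, Finset.sum_eq_single u₁.1.length]
  · simp only [wordM]
    split_ifs <;> simp_all
  · intro i hi hin
    have hw : wordM R u₁ (w.take i) = 0 := if_neg fun h => hin <| by
      rw [← hlen h, List.length_take, min_eq_left (Finset.mem_Ioo.1 hi).2.le]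
    rw [hw, zero_mul, ite_self]
  · intro hw
    have hw' : wordM R u₂ (w.drop u₁.1.length) = 0 := if_neg fun h => hw <| by
      have := hlen h
      rw [List.length_drop] at this
      exact Finset.mem_Ioo.2 (by omega)
    rw [hw', mul_zero, ite_self]

theorem eq_sum_M {R : Type*} [CommRing R] {f : WQSym R} {s : Finset PackedWord}
    (h1 : ∀ v ∈ s, f.1 v.1 = 1) (h0 : ∀ v, v ∉ s → f.1 v.1 = 0) : f = ∑ v ∈ s, M R v := by
  apply Subtype.ext
  funext w
  rw [← (mem_WQSym_iff.1 f.2).1 w, AddSubmonoidClass.coe_finsetSum, Finset.sum_apply]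
  simp only [M, wordM, Finset.sum_ite_eq]
  split_ifs with h
  · exact h1 _ h
  · exact h0 _ h

theorem partialMul_M_eq_sum (R : Type*) [CommRing R] (r : ℕ → ℕ → Prop) [DecidableRel r]
    {u₁ u₂ : PackedWord} (h₁ : u₁.1 ≠ []) (h₂ : u₂.1 ≠ []) {f : WQSym R}
    (hf : f.1 = partialMul r (M R u₁).1 (M R u₂).1) :
    f = ∑ v ∈ strictImages (disjointConcat u₁.1 u₂.1) with
      r (maxLetter (v.1.take u₁.1.length)) (maxLetter (v.1.drop u₁.1.length)), M R v := by
  have hcoeff (v : PackedWord) := (congrFun hf v.1).trans (partialMul_wordM R r h₁ h₂ v.1)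
  refine eq_sum_M (fun v hv => ?_) fun v hv => ?_ <;>
    rw [Finset.mem_filter, mem_strictImages_disjointConcat] at hv
  · rw [hcoeff, if_pos hv]
  · rw [hcoeff, if_neg hv]

theorem IsLayering.maxLetter_take_drop_heightWord {u₁ u₂ : PackedWord} (h₁ : u₁.1 ≠ [])
    (h₂ : u₂.1 ≠ []) {L : List (Finset (ℕ ⊕ ℕ))}
    (hL : IsLayering (disjointConcat u₁.1 u₂.1).toFinset L) :
    maxLetter ((heightWord (disjointConcat u₁.1 u₂.1) L).1.take u₁.1.length) =
        height L (Sum.inl (maxLetter u₁.1)) ∧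
      maxLetter ((heightWord (disjointConcat u₁.1 u₂.1) L).1.drop u₁.1.length) =
        height L (Sum.inr (maxLetter u₂.1)) := by
  have hmono := hL.strictMonoOn_height
  rw [hL.coe_heightWord, disjointConcat, List.map_append, List.map_map, List.map_map,
    List.take_left' (List.length_map _), List.drop_left' (List.length_map _)]
  refine ⟨maxLetter_map h₁ _ fun a ha b hb hab => hmono ?_ ?_ (Sum.inl_lt_inl_iff.2 hab),
    maxLetter_map h₂ _ fun a ha b hb hab => hmono ?_ ?_ (Sum.inr_lt_inr_iff.2 hab)⟩ <;>
    simpa [disjointConcat]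

theorem atX_sum {K : Type*} [Field K] {ι : Type*} (s : Finset ι) (f : ι → WQSym (RatFunc K)) :
    atX (∑ i ∈ s, f i) = ∑ i ∈ s, atX (f i) := by
  simp only [atX, map_sum]

theorem eq_disjSum_iff {ι κ : Type*} {a : ι} {b : κ} {A : Finset ι} {B : Finset κ}
    {S : Finset (ι ⊕ κ)} (hS : S ⊆ Finset.disjSum {a} {b}) (hA : A ⊆ {a}) (hB : B ⊆ {b}) :
    S = A.disjSum B ↔ (Sum.inl a ∈ S ↔ a ∈ A) ∧ (Sum.inr b ∈ S ↔ b ∈ B) := by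
  constructor
  · rintro rfl
    simp only [Finset.inl_mem_disjSum, Finset.inr_mem_disjSum, and_self]
  · rintro ⟨ha, hb⟩
    ext (i | i) <;> grind [Finset.inl_mem_disjSum, Finset.inr_mem_disjSum]

section Specialization

variable {K : Type*} [Field K] {r : ℕ → ℕ → Prop} [DecidableRel r] {u₁ u₂ : PackedWord}
  {f : WQSym (RatFunc K)}

theorem atX_eq_sum_layerings (h₁ : u₁.1 ≠ []) (h₂ : u₂.1 ≠ [])
    (hf : f.1 = partialMul r (M (RatFunc K) u₁).1 (M (RatFunc K) u₂).1) :
    atX f = ∑ L ∈ layerings (disjointConcat u₁.1 u₂.1).toFinset,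
      if r (height L (Sum.inl (maxLetter u₁.1))) (height L (Sum.inr (maxLetter u₂.1))) then
        atX (M (RatFunc K) (heightWord (disjointConcat u₁.1 u₂.1) L)) else 0 := by
  rw [partialMul_M_eq_sum _ r h₁ h₂ hf, atX_sum, Finset.sum_filter, sum_strictImages]
  refine Finset.sum_congr rfl fun L hL => ?_
  have hmax := (mem_layerings.1 hL).maxLetter_take_drop_heightWord h₁ h₂
  rw [hmax.1, hmax.2]

theorem sum_layerings_atX_M_disjointConcat (h₁ : u₁.1 ≠ []) (h₂ : u₂.1 ≠ []) {A B : Finset ℕ}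
    (hA : A ⊆ {maxLetter u₁.1}) (hB : B ⊆ {maxLetter u₂.1}) (hAB : (A.disjSum B).Nonempty) :
    ∑ L ∈ layerings ((disjointConcat u₁.1 u₂.1).toFinset \ A.disjSum B),
        atX (M (RatFunc K) (heightWord (disjointConcat u₁.1 u₂.1) (A.disjSum B :: L))) =
      (1 - t K ^ (∑ a ∈ A, u₁.1.count a + ∑ b ∈ B, u₂.1.count b)) /
          (1 - q K ^ (u₁.1.length + u₂.1.length)) *
        ((∏ a ∈ u₁.1.toFinset \ A, letterFactor K u₁.1 a) *
          ∏ b ∈ u₂.1.toFinset \ B, letterFactor K u₂.1 b) := by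
  have hT := toFinset_disjointConcat u₁.1 u₂.1
  have hforest : IsForest (disjointConcat u₁.1 u₂.1).toFinset := by
    rw [hT]
    exact (isForest_of_linearOrder _).disjSum (isForest_of_linearOrder _)
  have hsub : A.disjSum B ⊆ maximals (disjointConcat u₁.1 u₂.1).toFinset := by
    rw [hT, maximals_disjSum, maximals_toFinset h₁, maximals_toFinset h₂]
    exact Finset.disjSum_mono hA hB
  have hsdiff : (disjointConcat u₁.1 u₂.1).toFinset \ A.disjSum B =
      (u₁.1.toFinset \ A).disjSum (u₂.1.toFinset \ B) := by
    rw [hT]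
    ext (i | i) <;> simp
  have hlen : (disjointConcat u₁.1 u₂.1).length = u₁.1.length + u₂.1.length := by
    rw [disjointConcat, List.length_append, List.length_map, List.length_map]
  rw [sum_layerings_atX_M_heightWord_cons hforest hAB hsub, hlen, hsdiff, Finset.prod_disjSum,
    Finset.sum_disjSum]
  simp only [letterFactor_disjointConcat_inl, letterFactor_disjointConcat_inr]
  rw [disjointConcat]
  simp only [count_map_append_map_left Sum.inl_injective (fun _ _ => Sum.inl_ne_inr),
    count_map_append_map_right Sum.inr_injective (fun _ _ => Sum.inl_ne_inr)]

theorem atX_eq_of_top_block (h₁ : u₁.1 ≠ []) (h₂ : u₂.1 ≠ [])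
    (hf : f.1 = partialMul r (M (RatFunc K) u₁).1 (M (RatFunc K) u₂).1) {A B : Finset ℕ}
    (hA : A ⊆ {maxLetter u₁.1}) (hB : B ⊆ {maxLetter u₂.1}) (hAB : (A.disjSum B).Nonempty)
    (hr : ∀ (S : Finset (ℕ ⊕ ℕ)) (L : List (Finset (ℕ ⊕ ℕ))),
      Sum.inl (maxLetter u₁.1) ∈ S ∨ Sum.inr (maxLetter u₂.1) ∈ S →
      (r (height (S :: L) (Sum.inl (maxLetter u₁.1)))
          (height (S :: L) (Sum.inr (maxLetter u₂.1))) ↔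
        (Sum.inl (maxLetter u₁.1) ∈ S ↔ maxLetter u₁.1 ∈ A) ∧
          (Sum.inr (maxLetter u₂.1) ∈ S ↔ maxLetter u₂.1 ∈ B))) :
    atX f = (1 - t K ^ (∑ a ∈ A, u₁.1.count a + ∑ b ∈ B, u₂.1.count b)) /
        (1 - q K ^ (u₁.1.length + u₂.1.length)) *
      ((∏ a ∈ u₁.1.toFinset \ A, letterFactor K u₁.1 a) *
        ∏ b ∈ u₂.1.toFinset \ B, letterFactor K u₂.1 b) := by
  have hmax : maximals (disjointConcat u₁.1 u₂.1).toFinset =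
      Finset.disjSum {maxLetter u₁.1} {maxLetter u₂.1} := by
    rw [toFinset_disjointConcat, maximals_disjSum, maximals_toFinset h₁, maximals_toFinset h₂]
  have hAB_mem : A.disjSum B ∈
      (Finset.disjSum {maxLetter u₁.1} {maxLetter u₂.1}).powerset.erase ∅ :=
    Finset.mem_erase.2 ⟨hAB.ne_empty, Finset.mem_powerset.2 (Finset.disjSum_mono hA hB)⟩
  have hT : (disjointConcat u₁.1 u₂.1).toFinset.Nonempty :=
    hAB.mono <| (Finset.disjSum_mono hA hB).trans <| hmax ▸ maximals_subset _
  have hr' : ∀ S ∈ (Finset.disjSum {maxLetter u₁.1} {maxLetter u₂.1}).powerset.erase ∅, ∀ L,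
      (r (height (S :: L) (Sum.inl (maxLetter u₁.1)))
        (height (S :: L) (Sum.inr (maxLetter u₂.1))) ↔ S = A.disjSum B) := by
    intro S hS L
    rw [Finset.mem_erase, Finset.mem_powerset] at hS
    have hmem : Sum.inl (maxLetter u₁.1) ∈ S ∨ Sum.inr (maxLetter u₂.1) ∈ S := by
      obtain ⟨i | i, hi⟩ := Finset.nonempty_iff_ne_empty.2 hS.1
      · exact Or.inl (by simpa [← show i = _ by simpa using hS.2 hi])
      · exact Or.inr (by simpa [← show i = _ by simpa using hS.2 hi])
    rw [hr S L hmem, eq_disjSum_iff hS.2 hA hB]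
  rw [atX_eq_sum_layerings h₁ h₂ hf, sum_layerings hT, hmax, Finset.sum_eq_single_of_mem _ hAB_mem,
    ← sum_layerings_atX_M_disjointConcat h₁ h₂ hA hB hAB]
  · exact Finset.sum_congr rfl fun L _ => if_pos ((hr' _ hAB_mem L).2 rfl)
  · exact fun S hS hne => Finset.sum_eq_zero fun L _ => if_neg fun h => hne ((hr' S hS L).1 h)

theorem atX_prec_M (h₁ : u₁.1 ≠ []) (h₂ : u₂.1 ≠ []) :
    atX (prec (M (RatFunc K) u₁) (M (RatFunc K) u₂)) =
      (1 - t K ^ Nmax u₁.1) / (1 - q K ^ (u₁.1.length + u₂.1.length)) *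
        (innerProd K u₁ *
          (hookFactor (q K) (t K) u₂.1.length (Nmax u₂.1) * innerProd K u₂)) := by
  rw [atX_eq_of_top_block (A := {maxLetter u₁.1}) (B := ∅) h₁ h₂ rfl (by simp) (by simp) (by simp)
    fun S L h => by
      rw [gt_iff_lt, height_cons_lt_height_cons_iff h.symm]
      simpa using h.resolve_right,
    Finset.sum_singleton, Finset.sum_empty, Finset.sdiff_empty, prod_letterFactor h₂]
  rfl

theorem atX_mid_M (h₁ : u₁.1 ≠ []) (h₂ : u₂.1 ≠ []) :
    atX (mid (M (RatFunc K) u₁) (M (RatFunc K) u₂)) =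
      (1 - t K ^ (Nmax u₁.1 + Nmax u₂.1)) / (1 - q K ^ (u₁.1.length + u₂.1.length)) *
        (innerProd K u₁ * innerProd K u₂) := by
  rw [atX_eq_of_top_block (A := {maxLetter u₁.1}) (B := {maxLetter u₂.1}) h₁ h₂ rfl (by simp)
    (by simp) ⟨Sum.inl (maxLetter u₁.1), by simp⟩
    fun S L h => by simp [height_cons_eq_height_cons_iff h],
    Finset.sum_singleton, Finset.sum_singleton]
  rfl

theorem atX_succ_M (h₁ : u₁.1 ≠ []) (h₂ : u₂.1 ≠ []) :
    atX (succ (M (RatFunc K) u₁) (M (RatFunc K) u₂)) =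
      (1 - t K ^ Nmax u₂.1) / (1 - q K ^ (u₁.1.length + u₂.1.length)) *
        (hookFactor (q K) (t K) u₁.1.length (Nmax u₁.1) * innerProd K u₁ * innerProd K u₂) := by
  rw [atX_eq_of_top_block (A := ∅) (B := {maxLetter u₂.1}) h₁ h₂ rfl (by simp) (by simp) (by simp)
    fun S L h => by
      rw [height_cons_lt_height_cons_iff h]
      simpa using h.resolve_left,
    Finset.sum_singleton, Finset.sum_empty, Finset.sdiff_empty, prod_letterFactor h₁, zero_add]
  rfl

theorem Nmax_pos {w : List ℕ} (hne : w ≠ []) : 0 < Nmax w :=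
  List.count_pos_iff.2 (maxLetter_mem hne)

end Specialization

end PartialProducts

end WordQSym

theorem mainTheorem11 (K : Type*) [Field K] (n m : ℕ) (hn : 0 < n) (hm : 0 < m)
    (u₁ u₂ : WordQSym.PackedWord) (h₁ : u₁ ∈ WordQSym.PW n) (h₂ : u₂ ∈ WordQSym.PW m) :
    WordQSym.atX (WordQSym.prec (WordQSym.M (RatFunc K) u₁) (WordQSym.M (RatFunc K) u₂)) =
        (1 - WordQSym.q K ^ n) / (1 - WordQSym.q K ^ (n + m)) *
          ((WordQSym.q K ^ m - WordQSym.t K ^ WordQSym.Nmax u₂.1) /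
            (1 - WordQSym.t K ^ WordQSym.Nmax u₂.1)) *
          (WordQSym.atX (WordQSym.M (RatFunc K) u₁) * WordQSym.atX (WordQSym.M (RatFunc K) u₂)) ∧
    WordQSym.atX (WordQSym.mid (WordQSym.M (RatFunc K) u₁) (WordQSym.M (RatFunc K) u₂)) =
        (1 - WordQSym.q K ^ n) * (1 - WordQSym.q K ^ m) / (1 - WordQSym.q K ^ (n + m)) *
          ((1 - WordQSym.t K ^ (WordQSym.Nmax u₁.1 + WordQSym.Nmax u₂.1)) /
            ((1 - WordQSym.t K ^ WordQSym.Nmax u₁.1) *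
              (1 - WordQSym.t K ^ WordQSym.Nmax u₂.1))) *
          (WordQSym.atX (WordQSym.M (RatFunc K) u₁) * WordQSym.atX (WordQSym.M (RatFunc K) u₂)) ∧
    WordQSym.atX (WordQSym.succ (WordQSym.M (RatFunc K) u₁) (WordQSym.M (RatFunc K) u₂)) =
        (1 - WordQSym.q K ^ m) / (1 - WordQSym.q K ^ (n + m)) *
          ((WordQSym.q K ^ n - WordQSym.t K ^ WordQSym.Nmax u₁.1) /
            (1 - WordQSym.t K ^ WordQSym.Nmax u₁.1)) *
          (WordQSym.atX (WordQSym.M (RatFunc K) u₁) * WordQSym.atX (WordQSym.M (RatFunc K) u₂)) := by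
  open WordQSym in
  rw [mem_PW] at h₁ h₂
  have hne₁ : u₁.1 ≠ [] := List.ne_nil_of_length_pos (h₁ ▸ hn)
  have hne₂ : u₂.1 ≠ [] := List.ne_nil_of_length_pos (h₂ ▸ hm)
  have hq₁ : 1 - q K ^ n ≠ 0 := one_sub_q_pow_ne_zero hn
  have hq₂ : 1 - q K ^ m ≠ 0 := one_sub_q_pow_ne_zero hm
  have hq₁₂ : 1 - q K ^ (n + m) ≠ 0 := one_sub_q_pow_ne_zero (Nat.add_pos_left hn m)
  have ht₁ : 1 - t K ^ Nmax u₁.1 ≠ 0 := one_sub_t_pow_ne_zero (Nmax_pos hne₁)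
  have ht₂ : 1 - t K ^ Nmax u₂.1 ≠ 0 := one_sub_t_pow_ne_zero (Nmax_pos hne₂)
  rw [atX_prec_M hne₁ hne₂, atX_mid_M hne₁ hne₂, atX_succ_M hne₁ hne₂,
    atX_M_eq_mul_innerProd hne₁, atX_M_eq_mul_innerProd hne₂, h₁, h₂, hookFactor, hookFactor]
  refine ⟨?_, ?_, ?_⟩ <;> field_simp
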